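/- \textbf{Theorem (robust superhedging duality).} Let $T\in\mathbb N$, let $(\Omega,\mathcal F,(\mathcal F_t)_{t=0,\dots,T},P)$ be a filtered probability space, and let $\Theta$ be a non-empty closed subset of a separable metric space. For every $\theta\in\Theta$ let $S^\theta=(S^\theta_t)_{0\le t\le T}$ be an adapted $\mathbb R^d$-valued process. Assume that whenever $\theta_n\to\theta$ in $\Theta$, there is a subsequence $(\theta_{n_k})_k$ with $S^{\theta_{n_k}}_t\to S^\theta_t$ a.s. for each $0\le t\le T$. Let $\mathcal A$ be the set of all predictable $\mathbb R^d$-valued processes $H=(H_t)_{1\le t\le T}$, i.e. $H_t$ is $\mathcal F_{t-1}$-measurable, and write $H\cdot S^\theta_T=\sum_{t=1}^T\langle H_t,S^\theta_t-S^\theta_{t-1}\rangle$. The condition \emph{No Robust Arbitrage} (NRA) holds if for every $H\in\mathcal A$ such that $H\cdot S^\theta_T\ge 0$ a.s. for all $\theta\in\Theta$, one has $H\cdot S^\theta_T=0$ a.s. for all $\theta\in\Theta$. A \emph{robust pricing system} is a family $\mathbf Q=(Z^\theta)_{\theta\in\Theta}\in\bigoplus_{\theta\in\Theta}L^\infty(\mathcal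 F_T,P)$ (only finitely many $Z^\theta$ are non-zero), acting by $\mathbf Q(\mathbf g)=\sum_{\theta}E[Z^\theta g^\theta]$ on all families $\mathbf g=(g^\theta)_{\theta\in\Theta}$ of random variables for which $Z^\theta g^\theta\in L^1(P)$ for every $\theta$, such that (i) $Z^\theta\ge 0$ for all $\theta$, and $E[Z^\theta 1_A]>0$ for some $\theta\in\Theta$ and $A\in\mathcal F_T$; (ii) $\mathbf Q(\mathbf 1)=1$; (iii) $Z^\theta S^\theta_t\in L^1(P)$ for all $\theta\in\Theta$ and $0\le t\le T$, and $\mathbf Q(1_A\mathbf S_t)=\mathbf Q(1_A\mathbf S_{t-1})$ for all $A\in\mathcal F_{t-1}$ and $1\le t\le T$, where $\mathbf S_t=(S_t^\theta)_{\theta\in\Theta}$. Let $\mathcal Q^\theta$ be the set of robust pricing systems with $Z^\theta\neq0$. Let $\mathbf f=(f^\theta)_{\theta\in\Theta}$ be a family of real-valued $\mathcal F_T$-measurable random variables; in $\sup_{\mathbf Q\in\mathcal Q^\theta}\mathbf Q(\mathbf f)$ the supremum is over those $\mathbf Q\in\mathcal Q^\theta$ for which $\mathbf Q(\mathbf f)$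 is defined, that is, $Z^{\theta'}f^{\theta'}\in L^1(P)$ for all $\theta'\in\Theta$ (every $\mathbf Q\in\mathcal Q^\theta$, if all $f^{\theta'}$ are in $L^1(P)$). Let $$\pi(\mathbf f)=\inf\{x\in\mathbb R:\ \exists H\in\mathcal A\ \text{such that } x+H\cdot S^\theta_T\ge f^\theta\ \text{a.s. for all }\theta\in\Theta\}.$$ If NRA holds and $\sup_{\theta\in\Theta}\sup_{\mathbf Q\in\mathcal Q^\theta}\mathbf Q(\mathbf f)<\infty$, then $\pi(\mathbf f)$ is finite, $$\pi(\mathbf f)=\sup_{\theta\in\Theta}\ \sup_{\mathbf Q\in\mathcal Q^\theta}\mathbf Q(\mathbf f),$$ and there exists $H\in\mathcal A$ such that $\pi(\mathbf f)+H\cdot S^\theta_T\ge f^\theta$ a.s. for all $\theta\in\Theta$. -/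

import Mathlib

open MeasureTheory Filter Topology
open scoped ENNReal

noncomputable section

namespace RobustFinance

variable {Ω Θ : Type*} {m : MeasurableSpace Ω} {d : ℕ}

/-- Continuity of the price model in the parameter: along every convergent sequence of parameters
some subsequence of the prices converges almost surely, at each date `0, …, T`. -/
def ContinuousInParameter [TopologicalSpace Θ] (P : Measure Ω) (T : ℕ)
    (S : Θ → ℕ → Ω → EuclideanSpace ℝ (Fin d)) : Prop :=
  ∀ (u : ℕ → Θ) (θ : Θ), Tendsto u atTop (𝓝 θ) →
    ∃ φ : ℕ → ℕ, StrictMono φ ∧ ∀ t ≤ T, ∀ᵐ ω ∂P,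
      Tendsto (fun k => S (u (φ k)) t ω) atTop (𝓝 (S θ t ω))

/-- Trading strategies: `H t` is the position held over the period from `t - 1` to `t`, and is
`ℱ (t - 1)`-measurable, `t = 1, …, T`. The riskless asset being constant equal to `1`, every
such process is the risky part of exactly one self-financing strategy with given initial capital.
The values of `H` outside `1, …, T` play no role. -/
def IsStrategy (ℱ : Filtration ℕ m) (T : ℕ) (H : ℕ → Ω → EuclideanSpace ℝ (Fin d)) : Prop :=
  ∀ t < T, Measurable[ℱ t] (H (t + 1))

/-- The gain `H · S_t = ∑_{s = 1}^t ⟨H_s, S_s - S_{s-1}⟩` of a strategy in one price model. -/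
def gain (H : ℕ → Ω → EuclideanSpace ℝ (Fin d)) (S : ℕ → Ω → EuclideanSpace ℝ (Fin d))
    (t : ℕ) (ω : Ω) : ℝ :=
  ∑ s ∈ Finset.range t, inner ℝ (H (s + 1) ω) (S (s + 1) ω - S s ω)

/-- No robust arbitrage: a strategy whose terminal gain is nonnegative in every model has zero
terminal gain in every model. -/
def NoRobustArbitrage (P : Measure Ω) (ℱ : Filtration ℕ m) (T : ℕ)
    (S : Θ → ℕ → Ω → EuclideanSpace ℝ (Fin d)) : Prop :=
  ∀ H : ℕ → Ω → EuclideanSpace ℝ (Fin d), IsStrategy ℱ T H →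
    (∀ θ, ∀ᵐ ω ∂P, 0 ≤ gain H (S θ) T ω) → ∀ θ, ∀ᵐ ω ∂P, gain H (S θ) T ω = 0

/-- `Q(f)` makes sense for the functional `Q` with densities `Z`: every term
`E[Z^θ f^θ]` is the expectation of an integrable variable. This is automatic
when all `f θ` are integrable and all `Z θ` are essentially bounded. -/
def PricingIntegrable {E : Type*} [NormedAddCommGroup E] [NormedSpace ℝ E] (P : Measure Ω)
    (Z : Θ →₀ (Ω → ℝ)) (f : Θ → Ω → E) : Prop :=
  ∀ θ, Integrable (fun ω => Z θ ω • f θ ω) P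

/-- The functional `Q(f) = ∑_θ E[Z^θ f^θ]` with the finitely many nonzero densities `Z`.
It is applied to real-valued and to `ℝ^d`-valued families. -/
def pricing {E : Type*} [NormedAddCommGroup E] [NormedSpace ℝ E] (P : Measure Ω)
    (Z : Θ →₀ (Ω → ℝ)) (f : Θ → Ω → E) : E :=
  ∑ θ ∈ Z.support, ∫ ω, Z θ ω • f θ ω ∂P

/-- Robust pricing systems, given by their densities: an element `Z` of the direct sum over `Θ`
of the spaces `L^∞(ℱ_T, P)`, i.e. a continuous linear functional on the product over `Θ`
of the spaces `L^1(ℱ_T, P)`. -/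
structure IsRobustPricingSystem (P : Measure Ω) (ℱ : Filtration ℕ m) (T : ℕ)
    (S : Θ → ℕ → Ω → EuclideanSpace ℝ (Fin d)) (Z : Θ →₀ (Ω → ℝ)) : Prop where
  measurable : ∀ θ, Measurable[ℱ T] (Z θ)
  bounded : ∀ θ, MemLp (Z θ) ∞ P
  nonneg : ∀ θ, ∀ᵐ ω ∂P, 0 ≤ Z θ ω
  pos : ∃ θ, ∃ A : Set Ω, MeasurableSet[ℱ T] A ∧ 0 < ∫ ω in A, Z θ ω ∂P
  pricing_one : pricing P Z (fun _ _ => (1 : ℝ)) = 1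
  integrable : ∀ t ≤ T, PricingIntegrable P Z (fun θ => S θ t)
  martingale : ∀ t < T, ∀ A : Set Ω, MeasurableSet[ℱ t] A →
    pricing P Z (fun θ => A.indicator (S θ (t + 1))) = pricing P Z (fun θ => A.indicator (S θ t))

/-- The robust pricing systems `𝒬^θ` for the model `θ`: those with `Z^θ ≠ 0` in `L^∞`. -/
def pricingSystems (P : Measure Ω) (ℱ : Filtration ℕ m) (T : ℕ)
    (S : Θ → ℕ → Ω → EuclideanSpace ℝ (Fin d)) (θ : Θ) : Set (Θ →₀ (Ω → ℝ)) :=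
  {Z | IsRobustPricingSystem P ℱ T S Z ∧ ¬ Z θ =ᵐ[P] 0}

/-- `sup_θ sup_{Q ∈ 𝒬^θ} Q(f)`, where `Q` runs over the systems for which `Q(f)` is defined. -/
def supPrice (P : Measure Ω) (ℱ : Filtration ℕ m) (T : ℕ)
    (S : Θ → ℕ → Ω → EuclideanSpace ℝ (Fin d)) (f : Θ → Ω → ℝ) : EReal :=
  ⨆ θ, ⨆ Z ∈ pricingSystems P ℱ T S θ, ⨆ _ : PricingIntegrable P Z f, ((pricing P Z f : ℝ) : EReal)

/-- The strategy `H` with initial capital `x` superhedges `f` in every model. -/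
def Superhedges (P : Measure Ω) (T : ℕ) (S : Θ → ℕ → Ω → EuclideanSpace ℝ (Fin d))
    (f : Θ → Ω → ℝ) (x : ℝ) (H : ℕ → Ω → EuclideanSpace ℝ (Fin d)) : Prop :=
  ∀ θ, ∀ᵐ ω ∂P, f θ ω ≤ x + gain H (S θ) T ω

/-- The robust superhedging price `π(f)`, an infimum in the extended real line. -/
def superhedgingPrice (P : Measure Ω) (ℱ : Filtration ℕ m) (T : ℕ)
    (S : Θ → ℕ → Ω → EuclideanSpace ℝ (Fin d)) (f : Θ → Ω → ℝ) : EReal :=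
  ⨅ x : ℝ, ⨅ _ : ∃ H, IsStrategy ℱ T H ∧ Superhedges P T S f x H, (x : EReal)

end RobustFinance

end

/-! Everything rests on an alternative, `exists_strategy_or_pricing_pos`: either one strategy
dominates the claims y^θ in all models at zero cost, or some robust pricing system Q has Q(y) > 0.
For y = 1, NRA rules out the first case, so some Q prices f and the supremum p is not -∞. For y = f
- p, the second case would give Q(f) > p, so the capital p superhedges. As no Q prices f above a
superhedging capital (`IsRobustPricingSystem.pricing_le`), p is the infimum and it is attained.

The alternative is Hahn-Banach in products of L¹ spaces, after dividing by a variable that dominates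
claims and prices. For a fixed ω, superhedging is a closed condition on price path and claim, so
countably many models with a.s. dense values represent all of them
(`exists_countable_ae_mem_closure`). If y is approximable in every finite subfamily of these, a
sequence of superreplicable claims converges to y a.s.; otherwise separation in one finite subfamily
yields Q with finite support.

The heart is closedness under a.s. limits (`exists_sum_ge_of_tendsto`). Strategies are cut into T *
d scalar trades, with induction on their number. Along a random subsequence that depends on the
first positions only, hence is common to all models, these positions converge or explode. Where they
explode, dividing by their size gives in the limit a strategy of nonnegative gain, so of zero gain
by NRA; subtracting multiples of it removes the first position. -/

namespace RobustFinance

/-! ### Random subsequences -/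

/-- A measurable selection of a strictly increasing sequence of indices. -/
lemma exists_measurable_strictMono {Ω : Type*} {m : MeasurableSpace Ω} (p : ℕ → ℕ → Ω → Prop)
    (hp : ∀ n j, MeasurableSet {ω | p n j ω}) (hfreq : ∀ n ω, ∃ᶠ j in atTop, p n j ω) :
    ∃ τ : ℕ → Ω → ℕ, (∀ n, Measurable (τ n)) ∧ (∀ ω, StrictMono fun n => τ n ω) ∧
      ∀ n ω, p n (τ n ω) ω := by
  classical
  have step : ∀ (n : ℕ) (σ : {σ : Ω → ℕ // Measurable σ}), ∃ σ' : {σ : Ω → ℕ // Measurable σ},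
      ∀ ω, σ.1 ω < σ'.1 ω ∧ p n (σ'.1 ω) ω := by
    rintro n ⟨σ, hσ⟩
    have hex : ∀ ω, ∃ j, σ ω < j ∧ p n j ω := fun ω => by
      obtain ⟨j, hj, hpj⟩ := frequently_atTop.1 (hfreq n ω) (σ ω + 1)
      exact ⟨j, hj, hpj⟩
    refine ⟨⟨fun ω => Nat.find (hex ω), measurable_find hex fun k => ?_⟩,
      fun ω => Nat.find_spec (hex ω)⟩
    exact (measurableSet_lt hσ measurable_const).inter (hp n k)
  choose next hnext using step
  let τ : ℕ → {σ : Ω → ℕ // Measurable σ} := fun n =>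
    Nat.rec (next 0 ⟨fun _ => 0, measurable_const⟩) (fun n σ => next (n + 1) σ) n
  refine ⟨fun n => (τ n).1, fun n => (τ n).2, fun ω => strictMono_nat_of_lt_succ fun n => ?_,
    fun n ω => ?_⟩
  · exact (hnext (n + 1) (τ n) ω).1
  · cases n with
    | zero => exact (hnext 0 _ ω).2
    | succ n => exact (hnext (n + 1) (τ n) ω).2

/-- Along a measurable random subsequence, a sequence of real random variables converges to a finite
limit `u` where `η = 0`, and diverges to `η * ∞` where `η = ± 1`. -/
lemma exists_measurable_subseq_limit {Ω : Type*} {m : MeasurableSpace Ω} (h : ℕ → Ω → ℝ)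
    (hh : ∀ n, Measurable (h n)) :
    ∃ (τ : ℕ → Ω → ℕ) (u η : Ω → ℝ), (∀ n, Measurable (τ n)) ∧
      (∀ ω, StrictMono fun n => τ n ω) ∧ Measurable u ∧ Measurable η ∧
      ∀ ω, (η ω = 0 ∧ Tendsto (fun n => h (τ n ω) ω) atTop (𝓝 (u ω))) ∨
        (η ω ^ 2 = 1 ∧ Tendsto (fun n => η ω * h (τ n ω) ω) atTop atTop) := by
  classical
  -- The limsup in the extended reals is measurable and is a cluster value at every ω. Its infinite
  -- values are the divergent cases η = ±1. In `p`, the index j is admissible at stage n if `h j` is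
  -- within 1/(n+1) of a finite limsup, or beyond ±n for an infinite one.
  set U : Ω → EReal := fun ω => limsup (fun n => ((h n ω : ℝ) : EReal)) atTop with hU
  have hUm : Measurable U := Measurable.limsup fun n => (hh n).coe_real_ereal
  let p : ℕ → ℕ → Ω → Prop := fun n j ω =>
    (U ω = ⊤ ∧ (n : ℝ) < h j ω) ∨ (U ω = ⊥ ∧ h j ω < -(n : ℝ)) ∨
      ((U ω ≠ ⊤ ∧ U ω ≠ ⊥) ∧ |h j ω - (U ω).toReal| < 1 / ((n : ℝ) + 1))
  have htop : MeasurableSet {ω | U ω = ⊤} := hUm (measurableSet_singleton _)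
  have hbot : MeasurableSet {ω | U ω = ⊥} := hUm (measurableSet_singleton _)
  obtain ⟨τ, hτ, hmono, hpτ⟩ := exists_measurable_strictMono p
    (fun n j => by
      refine (htop.inter (measurableSet_lt measurable_const (hh j))).union
        ((hbot.inter (measurableSet_lt (hh j) measurable_const)).union
          ((htop.compl.inter hbot.compl).inter ?_))
      exact measurableSet_lt (measurable_norm.comp ((hh j).sub hUm.ereal_toReal)) measurable_const)
    (fun n ω => by
      by_cases h1 : U ω = ⊤
      · have := frequently_lt_of_lt_limsup (f := atTop) (u := fun n => ((h n ω : ℝ) : EReal))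
          (b := ((n : ℝ) : EReal)) (by isBoundedDefault)
          (by change _ < U ω; rw [h1]; exact EReal.coe_lt_top _)
        exact this.mono fun j hj => Or.inl ⟨h1, EReal.coe_lt_coe_iff.1 hj⟩
      · by_cases h2 : U ω = ⊥
        · have := eventually_lt_of_limsup_lt (f := atTop) (u := fun n => ((h n ω : ℝ) : EReal))
            (b := ((-(n : ℝ) : ℝ) : EReal))
            (by change U ω < _; rw [h2]; exact EReal.bot_lt_coe _)
          exact this.frequently.mono fun j hj => Or.inr (Or.inl ⟨h2, EReal.coe_lt_coe_iff.1 hj⟩)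
        · have hpos : (0 : ℝ) < 1 / ((n : ℝ) + 1) := by positivity
          have hcoe := EReal.coe_toReal h1 h2
          have f1 := frequently_lt_of_lt_limsup (f := atTop)
            (u := fun n => ((h n ω : ℝ) : EReal))
            (b := (((U ω).toReal - 1 / ((n : ℝ) + 1) : ℝ) : EReal)) (by isBoundedDefault)
            (by
              change _ < U ω
              conv_rhs => rw [← hcoe]
              exact EReal.coe_lt_coe_iff.2 (by linarith))
          have f2 := eventually_lt_of_limsup_lt (f := atTop)
            (u := fun n => ((h n ω : ℝ) : EReal))
            (b := (((U ω).toReal + 1 / ((n : ℝ) + 1) : ℝ) : EReal))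
            (by
              change U ω < _
              conv_lhs => rw [← hcoe]
              exact EReal.coe_lt_coe_iff.2 (by linarith))
          refine (f1.and_eventually f2).mono fun j hj => Or.inr (Or.inr ⟨⟨h1, h2⟩, ?_⟩)
          have a := EReal.coe_lt_coe_iff.1 hj.1
          have b := EReal.coe_lt_coe_iff.1 hj.2
          rw [abs_lt]; constructor <;> linarith)
  refine ⟨τ, fun ω => (U ω).toReal, fun ω => if U ω = ⊤ then 1 else if U ω = ⊥ then -1 else 0,
    hτ, hmono, hUm.ereal_toReal, ?_, fun ω => ?_⟩
  · exact Measurable.ite htop measurable_const (Measurable.ite hbot measurable_const measurable_const)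
  · by_cases h1 : U ω = ⊤
    · right
      simp only [h1, if_true, one_pow, one_mul, true_and]
      refine tendsto_atTop_mono (fun n => ?_) tendsto_natCast_atTop_atTop
      have := hpτ n ω
      simp only [p, h1, true_and, ne_eq, not_true_eq_false, false_and, or_false, top_ne_bot] at this
      exact this.le
    · by_cases h2 : U ω = ⊥
      · right
        simp only [h2, if_true, bot_ne_top, if_false]
        refine ⟨by norm_num, tendsto_atTop_mono (fun n => ?_) tendsto_natCast_atTop_atTop⟩
        have := hpτ n ω
        simp only [p, h2, true_and, ne_eq, not_true_eq_false, false_and, or_false, and_false,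
          bot_ne_top, false_or] at this
        linarith
      · left
        simp only [h1, h2, if_false, true_and]
        rw [tendsto_iff_dist_tendsto_zero]
        refine squeeze_zero (fun _ => dist_nonneg) (fun n => ?_)
          (tendsto_one_div_add_atTop_nhds_zero_nat (𝕜 := ℝ))
        have := hpτ n ω
        simp only [p, h1, h2, ne_eq, not_false_eq_true, true_and, false_and, false_or] at this
        exact this.le

lemma measurable_comp_index {Ω : Type*} {m : MeasurableSpace Ω} {h : ℕ → Ω → ℝ}
    (hh : ∀ n, Measurable (h n)) {τ : Ω → ℕ} (hτ : Measurable τ) :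
    Measurable fun ω => h (τ ω) ω :=
  (measurable_from_prod_countable_right (f := fun q : ℕ × Ω => h q.1 q.2) hh).comp
    (hτ.prodMk measurable_id')

/-! ### Closedness of the superreplicable claims -/

/-- Under no arbitrage, superreplicability passes to almost sure limits. The integrators `X k i`
need not be adapted, or even measurable. -/
theorem exists_sum_ge_of_tendsto {Ω ι : Type*} {m : MeasurableSpace Ω} (μ : Measure Ω) (K : ℕ) :
    ∀ (G : ℕ → MeasurableSpace Ω), Monotone G → ∀ X : ℕ → ι → Ω → ℝ,
    (∀ h : ℕ → Ω → ℝ, (∀ k, Measurable[G k] (h k)) →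
      (∀ i, ∀ᵐ ω ∂μ, 0 ≤ ∑ k ∈ Finset.range K, h k ω * X k i ω) →
      ∀ i, ∀ᵐ ω ∂μ, ∑ k ∈ Finset.range K, h k ω * X k i ω = 0) →
    ∀ h : ℕ → ℕ → Ω → ℝ, (∀ n k, Measurable[G k] (h n k)) →
    ∀ (g : ℕ → ι → Ω → ℝ) (g' : ι → Ω → ℝ),
    (∀ i, ∀ᵐ ω ∂μ, Tendsto (fun n => g n i ω) atTop (𝓝 (g' i ω))) →
    (∀ n i, ∀ᵐ ω ∂μ, g n i ω ≤ ∑ k ∈ Finset.range K, h n k ω * X k i ω) →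
    ∃ h' : ℕ → Ω → ℝ, (∀ k, Measurable[G k] (h' k)) ∧
      ∀ i, ∀ᵐ ω ∂μ, g' i ω ≤ ∑ k ∈ Finset.range K, h' k ω * X k i ω := by
  induction K with
  | zero =>
    intro G hG X hNA h hh g g' hg hle
    refine ⟨h 0, hh 0, fun i => ?_⟩
    filter_upwards [hg i, ae_all_iff.2 fun n => hle n i] with ω h1 h2
    exact le_of_tendsto' h1 fun n => by simpa using h2 n
  | succ K ih =>
    intro G hG X hNA h hh g g' hg hle
    simp only [Finset.sum_range_succ'] at hNA hle ⊢
    -- The later trades inherit no arbitrage, being extended by a zero first trade.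
    have IH := ih (fun k => G (k + 1)) (fun a b hab => hG (by lia)) (fun k => X (k + 1))
      (fun h hh h0 => by
        have := hNA (fun k => Nat.casesOn k (fun _ => 0) h)
          (fun k => by cases k with
            | zero => exact @measurable_const _ _ _ (G 0) _
            | succ k => exact hh k)
          (fun i => by simpa using h0 i)
        intro i; simpa using this i)
    have cons : ∀ (a : Ω → ℝ) (b : ℕ → Ω → ℝ), Measurable[G 0] a → (∀ k, Measurable[G (k + 1)] (b k)) →
        ∀ k, Measurable[G k] (Nat.casesOn (motive := fun _ => Ω → ℝ) k a b) := by
      intro a b ha hb k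
      cases k with
      | zero => exact ha
      | succ k => exact hb k
    obtain ⟨τ, u, η, hτ, hmono, hu, hη, hlim⟩ :=
      @exists_measurable_subseq_limit Ω (G 0) (fun n => h n 0) (fun n => hh n 0)
    have hsub : ∀ n k, Measurable[G k] fun ω => h (τ n ω) k ω := fun n k =>
      measurable_comp_index (fun n => hh n k) ((hτ n).mono (hG (Nat.zero_le k)) le_rfl)
    have hg_sub : ∀ i, ∀ᵐ ω ∂μ, Tendsto (fun n => g (τ n ω) i ω) atTop (𝓝 (g' i ω)) := fun i => by
      filter_upwards [hg i] with ω h1 using h1.comp (hmono ω).tendsto_atTop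
    have hle_sub : ∀ n i, ∀ᵐ ω ∂μ, g (τ n ω) i ω ≤
        ∑ k ∈ Finset.range K, h (τ n ω) (k + 1) ω * X (k + 1) i ω + h (τ n ω) 0 ω * X 0 i ω :=
      fun n i => by
        filter_upwards [ae_all_iff.2 fun n => hle n i] with ω h1 using h1 _
    have up : ∀ {a : Ω → ℝ} (k : ℕ), Measurable[G 0] a → Measurable[G k] a := fun k ha =>
      ha.mono (hG (Nat.zero_le k)) le_rfl
    -- a strategy with zero gain and first component `η`
    obtain ⟨e, he, hge⟩ := IH
      (fun n k ω => η ω ^ 2 * h (τ n ω) (k + 1) ω / max 1 |h (τ n ω) 0 ω|)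
      (fun n k => by
        let := G (k + 1)
        exact (((up (k + 1) hη).pow_const 2).mul (hsub n (k + 1))).div
          (measurable_const.max (measurable_norm.comp (up (k + 1) (hsub n 0)))))
      (fun n i ω => η ω ^ 2 * (g (τ n ω) i ω - h (τ n ω) 0 ω * X 0 i ω) / max 1 |h (τ n ω) 0 ω|)
      (fun i ω => - (η ω * X 0 i ω))
      (fun i => by
        filter_upwards [hg_sub i] with ω h1
        rcases hlim ω with ⟨h0, -⟩ | ⟨h0, h2⟩
        · simp [h0]
        -- The cutoff at 1 keeps the divisor positive everywhere; on the divergence set it is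
        -- eventually inactive.
        · have habs : ∀ᶠ n in atTop, max 1 |h (τ n ω) 0 ω| = η ω * h (τ n ω) 0 ω := by
            filter_upwards [h2.eventually_ge_atTop 1] with n hn
            have : |η ω| = 1 := by
              have := sq_abs (η ω); rw [h0] at this
              exact (pow_eq_one_iff_of_nonneg (abs_nonneg _) two_ne_zero).1 this
            rw [show |h (τ n ω) 0 ω| = η ω * h (τ n ω) 0 ω by
              rw [← abs_of_nonneg (zero_le_one.trans hn), abs_mul, this, one_mul], max_eq_right hn]
          have h3 : Tendsto (fun n => g (τ n ω) i ω * (η ω * h (τ n ω) 0 ω)⁻¹ - η ω * X 0 i ω)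
              atTop (𝓝 (g' i ω * 0 - η ω * X 0 i ω)) :=
            (h1.mul h2.inv_tendsto_atTop).sub_const _
          rw [mul_zero, zero_sub] at h3
          refine h3.congr' ?_
          filter_upwards [habs, h2.eventually_ge_atTop 1] with n hn hn1
          rw [hn, h0]
          have hne : η ω * h (τ n ω) 0 ω ≠ 0 := by positivity
          rw [one_mul, sub_div, div_eq_mul_inv]
          congr 1
          rw [eq_div_iff hne]
          linear_combination (h (τ n ω) 0 ω * X 0 i ω) * h0)
      (fun n i => by
        filter_upwards [hle_sub n i] with ω h1
        have : ∑ k ∈ Finset.range K, η ω ^ 2 * h (τ n ω) (k + 1) ω / max 1 |h (τ n ω) 0 ω| *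
            X (k + 1) i ω = η ω ^ 2 * (∑ k ∈ Finset.range K, h (τ n ω) (k + 1) ω * X (k + 1) i ω) /
            max 1 |h (τ n ω) 0 ω| := by
          rw [Finset.mul_sum, Finset.sum_div]
          exact Finset.sum_congr rfl fun k _ => by ring
        rw [this]
        gcongr
        linarith)
    -- Where η ≠ 0, the trades e gain at least -η X 0, so the strategy (η, η² e) has nonnegative
    -- gain in every model.
    have hzero : ∀ i, ∀ᵐ ω ∂μ, ∑ k ∈ Finset.range K, (η ω ^ 2 * e k ω) * X (k + 1) i ω +
        η ω * X 0 i ω = 0 := by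
      refine hNA (fun k => Nat.casesOn k η fun k ω => η ω ^ 2 * e k ω)
        (cons _ _ hη fun k => ?_) fun i => ?_
      · let := G (k + 1)
        exact ((up (k + 1) hη).pow_const 2).mul (he k)
      · filter_upwards [hge i] with ω h1
        simp only [mul_assoc, ← Finset.mul_sum]
        rcases hlim ω with ⟨h0, -⟩ | ⟨h0, -⟩
        · simp [h0]
        · rw [h0]; change 0 ≤ 1 * _ + η ω * X 0 i ω; linarith
    -- Subtracting η h 0 times the zero-gain strategy leaves the first position (1 - η²) h 0: zero
    -- on the divergence set, convergent to u elsewhere. It can therefore be moved into the claim.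
    obtain ⟨h', hh', hgh⟩ := IH
      (fun n k ω => h (τ n ω) (k + 1) ω - η ω * h (τ n ω) 0 ω * (η ω ^ 2 * e k ω))
      (fun n k => by
        let := G (k + 1)
        exact (hsub n (k + 1)).sub (((up (k + 1) hη).mul (up (k + 1) (hsub n 0))).mul
          (((up (k + 1) hη).pow_const 2).mul (he k))))
      (fun n i ω => g (τ n ω) i ω - (1 - η ω ^ 2) * h (τ n ω) 0 ω * X 0 i ω)
      (fun i ω => g' i ω - (1 - η ω ^ 2) * u ω * X 0 i ω)
      (fun i => by
        filter_upwards [hg_sub i] with ω h1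
        rcases hlim ω with ⟨h0, h2⟩ | ⟨h0, -⟩
        · exact h1.sub ((h2.const_mul _).mul_const _)
        · simpa [h0] using h1)
      (fun n i => by
        filter_upwards [hle_sub n i, hzero i] with ω h1 h2
        simp only [sub_mul, Finset.sum_sub_distrib]
        have h3 : ∑ k ∈ Finset.range K, η ω * h (τ n ω) 0 ω * (η ω ^ 2 * e k ω) * X (k + 1) i ω
            = η ω * h (τ n ω) 0 ω *
              ∑ k ∈ Finset.range K, (η ω ^ 2 * e k ω) * X (k + 1) i ω := by
          rw [Finset.mul_sum]
          exact Finset.sum_congr rfl fun k _ => by ring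
        rw [h3, eq_neg_of_add_eq_zero_left h2]
        linarith)
    refine ⟨fun k => Nat.casesOn k (fun ω => (1 - η ω ^ 2) * u ω) h', cons _ _ ?_ hh', fun i => ?_⟩
    · let := G 0
      exact (measurable_const.sub (hη.pow_const 2)).mul hu
    · filter_upwards [hgh i] with ω h1
      simpa using by linarith

/-! ### Duality and separation in L¹ -/

/-- Positive continuous functionals on `L¹` of a probability measure have bounded densities. -/
lemma exists_bounded_density {Ω : Type*} {m : MeasurableSpace Ω} (P : Measure Ω)
    [IsProbabilityMeasure P] (ℓ : Lp ℝ 1 P →L[ℝ] ℝ)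
    (hpos : ∀ g : Lp ℝ 1 P, 0 ≤ᵐ[P] g → 0 ≤ ℓ g) :
    ∃ (W : Ω → ℝ) (C : ℝ), Measurable W ∧ (∀ᵐ ω ∂P, 0 ≤ W ω ∧ W ω ≤ C) ∧
      ∀ g : Lp ℝ 1 P, ℓ g = ∫ ω, W ω * g ω ∂P := by
  have h1 : ∀ f : Lp ℝ 2 P, MemLp f 1 P := fun f => (Lp.memLp f).mono_exponent (by norm_num)
  let J : Lp ℝ 2 P →ₗ[ℝ] Lp ℝ 1 P :=
    { toFun := fun f => (h1 f).toLp
      map_add' := fun f g => by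
        rw [← MemLp.toLp_add]; exact MemLp.toLp_congr _ _ (Lp.coeFn_add f g)
      map_smul' := fun c f => by
        rw [RingHom.id_apply, ← MemLp.toLp_const_smul]
        exact MemLp.toLp_congr _ _ (Lp.coeFn_smul c f) }
  let JL : Lp ℝ 2 P →L[ℝ] Lp ℝ 1 P := J.mkContinuous 1 fun f => by
    rw [one_mul]
    change ‖(h1 f).toLp‖ ≤ ‖f‖
    rw [Lp.norm_toLp, Lp.norm_def]
    exact ENNReal.toReal_mono (Lp.eLpNorm_ne_top f)
      (eLpNorm_le_eLpNorm_of_exponent_le (by norm_num) (Lp.aestronglyMeasurable f))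
  -- The restriction of ℓ to L² has a Riesz representative. Testing on indicators places it between
  -- 0 and ‖ℓ‖, and density of simple functions extends the formula to L¹.
  set V : Lp ℝ 2 P := (InnerProductSpace.toDual ℝ _).symm (ℓ.comp JL) with hV
  have hVint : Integrable V P := memLp_one_iff_integrable.1 (h1 V)
  have hset : ∀ (A : Set Ω) (hA : MeasurableSet A),
      ∫ ω in A, V ω ∂P = ℓ (indicatorConstLp 1 hA (measure_ne_top P A) (1 : ℝ)) := fun A hA => by
    rw [← L2.inner_indicatorConstLp_one (𝕜 := ℝ) hA (measure_ne_top P A) V, real_inner_comm, hV,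
      InnerProductSpace.toDual_symm_apply]
    change ℓ ((h1 (indicatorConstLp 2 hA (measure_ne_top P A) (1 : ℝ))).toLp) = _
    congr 1
    exact MemLp.toLp_congr _ _ indicatorConstLp_coeFn
  have hV0 : 0 ≤ᵐ[P] V := ae_nonneg_of_forall_setIntegral_nonneg hVint fun A hA _ => by
    rw [hset A hA]
    refine hpos _ ?_
    filter_upwards [indicatorConstLp_coeFn (p := 1) (hs := hA) (hμs := measure_ne_top P A)
      (c := (1 : ℝ))] with ω hω
    rw [hω]
    exact Set.indicator_nonneg (fun _ _ => zero_le_one) _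
  have hVC : V ≤ᵐ[P] fun _ => ‖ℓ‖ :=
    ae_le_of_forall_setIntegral_le hVint (integrable_const _) fun A hA _ => by
      rw [hset A hA, setIntegral_const, smul_eq_mul]
      refine (le_abs_self _).trans ((ℓ.le_opNorm _).trans ?_)
      rw [norm_indicatorConstLp one_ne_zero ENNReal.one_ne_top]
      simp [mul_comm]
  obtain ⟨W, hW, hVW⟩ := (Lp.aestronglyMeasurable V).aemeasurable
  have hWb : ∀ᵐ ω ∂P, 0 ≤ W ω ∧ W ω ≤ ‖ℓ‖ := by
    filter_upwards [hV0, hVC, hVW] with ω a b c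
    rw [← c]; exact ⟨a, b⟩
  have hWn : ∀ᵐ ω ∂P, ‖W ω‖ ≤ ‖ℓ‖ := by
    filter_upwards [hWb] with ω hω
    rw [Real.norm_eq_abs, abs_of_nonneg hω.1]; exact hω.2
  have hint : ∀ {g : Ω → ℝ}, Integrable g P → Integrable (fun ω => W ω * g ω) P :=
    fun hg => hg.bdd_mul hW.aestronglyMeasurable hWn
  refine ⟨W, ‖ℓ‖, hW, hWb, fun g => ?_⟩
  -- the integral against `W`, as a continuous functional
  let I : Lp ℝ 1 P →ₗ[ℝ] ℝ :=
    { toFun := fun g => ∫ ω, W ω * g ω ∂P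
      map_add' := fun f g => by
        rw [← integral_add (hint (L1.integrable_coeFn f)) (hint (L1.integrable_coeFn g))]
        refine integral_congr_ae ?_
        filter_upwards [Lp.coeFn_add f g] with ω hω
        rw [hω, Pi.add_apply, mul_add]
      map_smul' := fun c f => by
        rw [RingHom.id_apply, smul_eq_mul, ← integral_const_mul]
        refine integral_congr_ae ?_
        filter_upwards [Lp.coeFn_smul c f] with ω hω
        rw [hω, Pi.smul_apply, smul_eq_mul]; ring }
  let IL : Lp ℝ 1 P →L[ℝ] ℝ := I.mkContinuous ‖ℓ‖ fun f => by
    change ‖∫ ω, W ω * f ω ∂P‖ ≤ _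
    rw [L1.norm_eq_integral_norm, ← integral_const_mul]
    refine norm_integral_le_of_norm_le ((L1.integrable_coeFn f).norm.const_mul _) ?_
    filter_upwards [hWn] with ω hω
    rw [norm_mul]; gcongr
  change ℓ g = IL g
  refine Lp.induction ENNReal.one_ne_top (fun g => ℓ g = IL g) ?_ ?_ ?_ g
  · intro c s hs hμs
    have e : (↑(Lp.simpleFunc.indicatorConst 1 hs hμs.ne c) : Lp ℝ 1 P)
        = c • indicatorConstLp 1 hs (measure_ne_top P s) (1 : ℝ) := by
      rw [Lp.simpleFunc.coe_indicatorConst, indicatorConstLp, indicatorConstLp,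
        ← MemLp.toLp_const_smul]
      refine MemLp.toLp_congr _ _ (Eventually.of_forall fun ω => ?_)
      by_cases hω : ω ∈ s <;> simp [hω]
    rw [e, map_smul, map_smul, ← hset s hs]
    congr 1
    change _ = ∫ ω, W ω * _ ∂P
    rw [← integral_indicator hs]
    refine integral_congr_ae ?_
    filter_upwards [hVW, indicatorConstLp_coeFn (p := 1) (hs := hs) (hμs := measure_ne_top P s)
      (c := (1 : ℝ))] with ω a b
    rw [b]
    by_cases hω : ω ∈ s <;> simp [hω, a]
  · intro f g hf hg _ h1 h2
    rw [map_add, map_add, h1, h2]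
  · exact isClosed_eq ℓ.continuous IL.continuous

/-- Hahn-Banach separation of a point from a convex cone containing the negative orthant, in a
finite product of `L¹` spaces. -/
theorem exists_densities_separating {Ω ι : Type*} [Fintype ι] {m : MeasurableSpace Ω}
    (P : Measure Ω) [IsProbabilityMeasure P] (C : Set (ι → Lp ℝ 1 P)) (hconv : Convex ℝ C)
    (hcone : ∀ c ∈ C, ∀ r : ℝ, 0 < r → r • c ∈ C) (hneg : ∀ c, (∀ i, c i ≤ᵐ[P] 0) → c ∈ C)
    (y : ι → Lp ℝ 1 P) (hy : y ∉ closure C) :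
    ∃ (W : ι → Ω → ℝ) (B : ι → ℝ), (∀ i, Measurable (W i)) ∧
      (∀ i, ∀ᵐ ω ∂P, 0 ≤ W i ω ∧ W i ω ≤ B i) ∧
      (∀ c ∈ C, ∑ i, ∫ ω, W i ω * c i ω ∂P ≤ 0) ∧ 0 < ∑ i, ∫ ω, W i ω * y i ω ∂P := by
  classical
  obtain ⟨L, u, hL, hu⟩ := geometric_hahn_banach_closed_point hconv.closure isClosed_closure hy
  have hzero : (0 : ι → Lp ℝ 1 P) ∈ C := hneg 0 fun i => (Lp.coeFn_zero ℝ 1 P).le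
  have hu0 : 0 < u := by simpa using hL 0 (subset_closure hzero)
  -- Rescaling c by u / L c would reach the strict bound u.
  have hC : ∀ c ∈ C, L c ≤ 0 := fun c hc => by
    by_contra! hpos
    have := hL _ (subset_closure (hcone c hc (u / L c) (div_pos hu0 hpos)))
    rw [map_smul, smul_eq_mul, div_mul_cancel₀ _ hpos.ne'] at this
    exact lt_irrefl _ this
  let ℓ : ι → (Lp ℝ 1 P →L[ℝ] ℝ) := fun i => L.comp (ContinuousLinearMap.single ℝ (fun _ : ι => Lp ℝ 1 P) i)
  -- Positivity comes from the negative orthant, tested on -g in the single coordinate i.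
  have hℓ : ∀ i, ∀ g : Lp ℝ 1 P, 0 ≤ᵐ[P] g → 0 ≤ ℓ i g := fun i g hg => by
    have := hC (Pi.single i (-g)) (hneg _ fun j => by
      by_cases hij : j = i
      · subst hij
        rw [Pi.single_eq_same]
        filter_upwards [hg, Lp.coeFn_neg g] with ω a b
        rw [b]; simpa using a
      · rw [Pi.single_eq_of_ne hij]; exact (Lp.coeFn_zero ℝ 1 P).le)
    rw [Pi.single_neg, map_neg] at this
    exact neg_nonpos.1 this
  choose W B hW hWB hWℓ using fun i => exists_bounded_density P (ℓ i) (hℓ i)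
  have hsum : ∀ c, L c = ∑ i, ∫ ω, W i ω * c i ω ∂P := fun c => by
    simp only [← hWℓ]
    conv_lhs => rw [← Finset.univ_sum_single c, map_sum]
    rfl
  exact ⟨W, B, hW, hWB, fun c hc => hsum c ▸ hC c hc, hsum y ▸ hu0.trans hu⟩

/-! ### Nonnegative cost by backward conditioning -/

/-- A superhedging portfolio has nonnegative cost: if the integrands `X k` have zero conditional
mean given `G k`, and `g + ∑ h k * X k ≥ 0` for some predictable, possibly unbounded, `h`, then
`g` has nonnegative mean. -/
theorem integral_nonneg_of_add_sum_nonneg {Ω : Type*} {m : MeasurableSpace Ω} (P : Measure Ω)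
    [IsProbabilityMeasure P] (G : ℕ → MeasurableSpace Ω) (hG : Monotone G) (hGm : ∀ k, G k ≤ m)
    (h : ℕ → Ω → ℝ) (hh : ∀ k, Measurable[G k] (h k)) (K : ℕ) :
    ∀ (X : ℕ → Ω → ℝ) (g : Ω → ℝ), (∀ k < K, Integrable (X k) P) →
      (∀ k < K, P[X k | G k] =ᵐ[P] 0) → Integrable g P →
      (∀ᵐ ω ∂P, 0 ≤ g ω + ∑ k ∈ Finset.range K, h k ω * X k ω) → 0 ≤ ∫ ω, g ω ∂P := by
  induction K with
  | zero =>
    intro X g _ _ _ h0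
    refine integral_nonneg_of_ae ?_
    filter_upwards [h0] with ω hω
    simpa using hω
  | succ K ih =>
    intro X g hX hX0 hg hnn
    rw [← integral_condExp (hGm K)]
    -- Conditioning on `G K` kills the last term and projects the other integrands; since X and g
    -- change, they are quantified inside the induction.
    refine ih (fun k => P[X k | G K]) _ (fun k _ => integrable_condExp) (fun k hk => ?_)
      integrable_condExp ?_
    · exact (condExp_condExp_of_le (hG hk.le) (hGm K)).trans (hX0 k (by lia))
    -- Division by this `G K`-measurable variable makes all positions bounded, so that they can be
    -- pulled out of the conditional expectation.
    let D : Ω → ℝ := fun ω => 1 + ∑ k ∈ Finset.range (K + 1), |h k ω|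
    have hD : ∀ ω, 1 ≤ D ω := fun ω =>
      le_add_of_nonneg_right (Finset.sum_nonneg fun _ _ => abs_nonneg _)
    have hhK : ∀ k < K + 1, Measurable[G K] (h k) := fun k hk =>
      (hh k).mono (hG (by lia)) le_rfl
    have hDm : Measurable[G K] D := by
      let := G K
      exact measurable_const.add
        (Finset.measurable_sum _ fun k hk => measurable_norm.comp (hhK k (Finset.mem_range.1 hk)))
    have hw : StronglyMeasurable[G K] fun ω => (D ω)⁻¹ := hDm.inv.stronglyMeasurable
    have hwb : ∀ ω, ‖(D ω)⁻¹‖ ≤ 1 := fun ω => by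
      rw [norm_inv, Real.norm_of_nonneg (by linarith [hD ω])]
      exact inv_le_one_of_one_le₀ (hD ω)
    have hv : ∀ k < K + 1, StronglyMeasurable[G K] fun ω => (D ω)⁻¹ * h k ω := fun k hk => by
      let := G K
      exact (hDm.inv.mul (hhK k hk)).stronglyMeasurable
    have hvb : ∀ k < K + 1, ∀ ω, ‖(D ω)⁻¹ * h k ω‖ ≤ 1 := fun k hk ω => by
      have h1 := hD ω
      have h2 : |h k ω| ≤ D ω :=
        (Finset.single_le_sum (f := fun k => |h k ω|) (fun _ _ => abs_nonneg _)
          (Finset.mem_range.2 hk)).trans (by simp [D])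
      rw [norm_mul, norm_inv, Real.norm_of_nonneg (by linarith : 0 ≤ D ω), inv_mul_le_one₀
        (by linarith)]
      exact h2
    have key : ∀ (v f : Ω → ℝ), StronglyMeasurable[G K] v → (∀ ω, ‖v ω‖ ≤ 1) → Integrable f P →
        Integrable (v * f) P ∧ P[v * f | G K] =ᵐ[P] v * P[f | G K] := fun v f hv hb hf => by
      have hi : Integrable (v * f) P :=
        hf.bdd_mul (hv.mono (hGm K)).aestronglyMeasurable (ae_of_all _ hb)
      exact ⟨hi, condExp_mul_of_stronglyMeasurable_left hv hi hf⟩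
    have kX := fun k (hk : k < K + 1) => key _ _ (hv k hk) (hvb k hk) (hX k hk)
    have kg := key _ _ hw hwb hg
    have hsum : Integrable (∑ k ∈ Finset.range (K + 1), (fun ω => (D ω)⁻¹ * h k ω) * X k) P :=
      integrable_finsetSum' _ fun k hk => (kX k (Finset.mem_range.1 hk)).1
    have hpos : 0 ≤ᵐ[P] P[(fun ω => (D ω)⁻¹) * g +
        ∑ k ∈ Finset.range (K + 1), (fun ω => (D ω)⁻¹ * h k ω) * X k | G K] := by
      refine condExp_nonneg ?_
      filter_upwards [hnn] with ω hω
      have : ((fun ω => (D ω)⁻¹) * g + ∑ k ∈ Finset.range (K + 1),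
          (fun ω => (D ω)⁻¹ * h k ω) * X k) ω
          = (D ω)⁻¹ * (g ω + ∑ k ∈ Finset.range (K + 1), h k ω * X k ω) := by
        simp [Finset.sum_apply, mul_add, Finset.mul_sum, mul_assoc]
      rw [this]
      exact mul_nonneg (by have := hD ω; positivity) hω
    have hsplit := (condExp_add kg.1 hsum (G K)).trans
      (kg.2.add (condExp_finsetSum (fun k hk => (kX k (Finset.mem_range.1 hk)).1) (G K)))
    have hall : ∀ᵐ ω ∂P, ∀ k < K + 1, (P[(fun ω => (D ω)⁻¹ * h k ω) * X k | G K]) ω =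
        (D ω)⁻¹ * h k ω * (P[X k | G K]) ω := by
      rw [ae_all_iff]; intro k
      rw [ae_all_iff]; intro hk
      exact (kX k hk).2
    filter_upwards [hpos, hsplit, hall, hX0 K (by lia)] with ω a b c d
    rw [b] at a
    simp only [Pi.add_apply, Pi.mul_apply, Finset.sum_apply, Pi.zero_apply] at a
    rw [Finset.sum_congr rfl fun k hk => c k (Finset.mem_range.1 hk), Finset.sum_range_succ, d,
      Pi.zero_apply, mul_zero, add_zero] at a
    simp only [mul_assoc, ← Finset.mul_sum, ← mul_add] at a
    exact nonneg_of_mul_nonneg_right a (by have := hD ω; positivity)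

/-! ### Reduction to countably many models -/

/-- Up to null sets, a family of random variables lies in the closure of a countable subfamily. -/
theorem exists_countable_ae_mem_closure {Ω Θ E : Type*} {m : MeasurableSpace Ω} (P : Measure Ω)
    [IsFiniteMeasure P] [TopologicalSpace E] [SecondCountableTopology E] [MeasurableSpace E]
    [OpensMeasurableSpace E] (V : Θ → Ω → E) (hV : ∀ θ, Measurable (V θ)) :
    ∃ s : Set Θ, s.Countable ∧ ∀ θ, ∀ᵐ ω ∂P, V θ ω ∈ closure ((fun θ' => V θ' ω) '' s) := by
  have hsup : ∀ U : Set E, IsOpen U → ∃ s : Set Θ, s.Countable ∧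
      ∀ θ, P ((V θ ⁻¹' U) \ ⋃ θ' ∈ s, V θ' ⁻¹' U) = 0 := by
    intro U hU
    -- Exhaustion: the supremum of F is attained by a countable union, and adjoining one more θ to a
    -- maximiser adds only a null set.
    let F : {s : Set Θ // s.Countable} → ℝ≥0∞ := fun s => P (⋃ θ ∈ s.1, V θ ⁻¹' U)
    have : Nonempty {s : Set Θ // s.Countable} := ⟨⟨∅, Set.countable_empty⟩⟩
    obtain ⟨s, hs⟩ := exists_seq_tendsto_sSup (Set.range_nonempty F) (OrderTop.bddAbove _)
    choose t ht using hs.2.2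
    let S : {s : Set Θ // s.Countable} := ⟨⋃ n, (t n).1, Set.countable_iUnion fun n => (t n).2⟩
    have hmono : ∀ a b : {s : Set Θ // s.Countable}, a.1 ⊆ b.1 → F a ≤ F b := fun a b hab =>
      measure_mono (Set.biUnion_subset_biUnion_left hab)
    have hS : sSup (Set.range F) ≤ F S := le_of_tendsto' hs.2.1 fun n =>
      ht n ▸ hmono _ _ (Set.subset_iUnion (fun n => (t n).1) n)
    refine ⟨S.1, S.2, fun θ => ?_⟩
    have h1 : F ⟨insert θ S.1, S.2.insert θ⟩ ≤ F S := (le_sSup (Set.mem_range_self _)).trans hS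
    have hm : MeasurableSet (⋃ θ' ∈ S.1, V θ' ⁻¹' U) :=
      MeasurableSet.biUnion S.2 fun θ' _ => hV θ' hU.measurableSet
    have h2 : F ⟨insert θ S.1, S.2.insert θ⟩ =
        P ((V θ ⁻¹' U) \ ⋃ θ' ∈ S.1, V θ' ⁻¹' U) + F S := by
      simp only [F, Set.biUnion_insert]
      rw [← Set.sdiff_union_self, measure_union Set.disjoint_sdiff_left hm]
    rw [h2] at h1
    have := ENNReal.le_of_add_le_add_right (measure_ne_top P _) (h1.trans_eq (zero_add _).symm)
    exact le_antisymm this zero_le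
  choose s hs using fun U : TopologicalSpace.countableBasis E =>
    hsup U.1 (TopologicalSpace.isOpen_of_mem_countableBasis U.2)
  have : Countable (TopologicalSpace.countableBasis E) :=
    (TopologicalSpace.countable_countableBasis E).to_subtype
  refine ⟨⋃ U, s U, Set.countable_iUnion fun U => (hs U).1, fun θ => ?_⟩
  have hall : ∀ᵐ ω ∂P, ∀ U : TopologicalSpace.countableBasis E,
      ω ∉ (V θ ⁻¹' U.1) \ ⋃ θ' ∈ s U, V θ' ⁻¹' U.1 :=
    ae_all_iff.2 fun U => measure_eq_zero_iff_ae_notMem.1 ((hs U).2 θ)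
  filter_upwards [hall] with ω hω
  rw [(TopologicalSpace.isBasis_countableBasis E).mem_closure_iff]
  intro U hU hmem
  have h := hω ⟨U, hU⟩
  rw [Set.mem_sdiff, not_and, not_not] at h
  obtain ⟨θ', hθ', h'⟩ := Set.mem_iUnion₂.1 (h hmem)
  exact ⟨V θ' ω, h', θ', Set.mem_iUnion.2 ⟨_, hθ'⟩, rfl⟩

/-! ### Strategies as sequences of scalar trades -/

/-- The `i`-th coordinate functional, zero when `i` is out of range. -/
noncomputable def coord {d : ℕ} (i : ℕ) : EuclideanSpace ℝ (Fin d) →L[ℝ] ℝ :=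
  if hi : i < d then EuclideanSpace.proj ⟨i, hi⟩ else 0

lemma coord_apply {d i : ℕ} (hi : i < d) (v : EuclideanSpace ℝ (Fin d)) :
    coord i v = v ⟨i, hi⟩ := by
  simp [coord, hi]

lemma inner_eq_sum_coord {d : ℕ} (v w : EuclideanSpace ℝ (Fin d)) :
    inner ℝ v w = ∑ i ∈ Finset.range d, coord i v * coord i w := by
  rw [Finset.sum_range, PiLp.inner_apply]
  refine Finset.sum_congr rfl fun i _ => ?_
  rw [coord_apply i.2, coord_apply i.2]
  simp [mul_comm]

/-- Numbering (date, asset) pairs as k = s * d + i makes the d trades of one date successive scalar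
trades with the same information ℱ (k / d). -/
lemma sum_range_mul_div_mod {M : Type*} [AddCommMonoid M] (F : ℕ → ℕ → M) (T d : ℕ) :
    ∑ k ∈ Finset.range (T * d), F (k / d) (k % d) =
      ∑ s ∈ Finset.range T, ∑ i ∈ Finset.range d, F s i := by
  induction T with
  | zero => simp
  | succ T ih =>
    rw [Nat.succ_mul, Finset.sum_range_add, ih, Finset.sum_range_succ]
    congr 1
    refine Finset.sum_congr rfl fun i hi => ?_
    have hi := Finset.mem_range.1 hi
    have hd : 0 < d := by lia
    rw [mul_comm T d, Nat.mul_add_div hd, Nat.mul_add_mod, Nat.div_eq_of_lt hi,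
      Nat.mod_eq_of_lt hi, add_zero]

lemma sum_inner_eq_sum_coord {d : ℕ} (a b : ℕ → EuclideanSpace ℝ (Fin d)) (T : ℕ) :
    ∑ s ∈ Finset.range T, inner ℝ (a s) (b s) =
      ∑ k ∈ Finset.range (T * d), coord (k % d) (a (k / d)) * coord (k % d) (b (k / d)) := by
  rw [sum_range_mul_div_mod fun s i => coord i (a s) * coord i (b s)]
  exact Finset.sum_congr rfl fun s _ => inner_eq_sum_coord _ _

lemma gain_eq_sum_coord {Ω : Type*} {d : ℕ} (H S : ℕ → Ω → EuclideanSpace ℝ (Fin d)) (T : ℕ)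
    (ω : Ω) : gain H S T ω = ∑ k ∈ Finset.range (T * d),
      coord (k % d) (H (k / d + 1) ω) * coord (k % d) (S (k / d + 1) ω - S (k / d) ω) :=
  sum_inner_eq_sum_coord (fun s => H (s + 1) ω) (fun s => S (s + 1) ω - S s ω) T

lemma div_lt_of_lt_mul {k T d : ℕ} (hk : k < T * d) : k / d < T :=
  Nat.div_lt_of_lt_mul (by rwa [mul_comm])

lemma IsStrategy.measurable_coord {Ω : Type*} {m : MeasurableSpace Ω} {d T : ℕ}
    {ℱ : Filtration ℕ m} {H : ℕ → Ω → EuclideanSpace ℝ (Fin d)} (hH : IsStrategy ℱ T H) (k : ℕ) :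
    Measurable[ℱ (k / d)] fun ω => if k < T * d then coord (k % d) (H (k / d + 1) ω) else 0 := by
  by_cases hk : k < T * d
  · simp only [hk, if_true]
    exact (coord (k % d)).continuous.measurable.comp (hH _ (div_lt_of_lt_mul hk))
  · simp only [hk, if_false]
    exact measurable_const

/-- The strategy with given scalar coordinates. -/
lemma exists_strategy_of_coord {Ω : Type*} {m : MeasurableSpace Ω} {d T : ℕ}
    {ℱ : Filtration ℕ m} (h : ℕ → Ω → ℝ) (hh : ∀ k, Measurable[ℱ (k / d)] (h k)) :
    ∃ H : ℕ → Ω → EuclideanSpace ℝ (Fin d), IsStrategy ℱ T H ∧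
      ∀ k < T * d, ∀ ω, coord (k % d) (H (k / d + 1) ω) = h k ω := by
  refine ⟨fun s ω => WithLp.toLp 2 fun i : Fin d => h ((s - 1) * d + i) ω, fun t _ => ?_,
    fun k hk ω => ?_⟩
  · let := ℱ t
    refine (WithLp.measurable_toLp 2 _).comp (measurable_pi_lambda _ fun i => ?_)
    have hi := hh (t * d + i)
    have hdiv : (t * d + i) / d = t := by
      rw [mul_comm t d, Nat.mul_add_div i.pos, Nat.div_eq_of_lt i.2, add_zero]
    rw [hdiv] at hi
    exact hi
  · have hd : 0 < d := Nat.pos_of_ne_zero (by rintro rfl; simp at hk)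
    rw [coord_apply (Nat.mod_lt _ hd)]
    change h ((k / d + 1 - 1) * d + k % d) ω = h k ω
    rw [add_tsub_cancel_right, Nat.div_add_mod']

/-- The set of superreplicable claims is closed under almost sure convergence. -/
theorem exists_strategy_of_tendsto {Ω ι : Type*} {m : MeasurableSpace Ω} {d : ℕ} (P : Measure Ω)
    (ℱ : Filtration ℕ m) (T : ℕ) (S : ι → ℕ → Ω → EuclideanSpace ℝ (Fin d))
    (hNA : NoRobustArbitrage P ℱ T S) (H : ℕ → ℕ → Ω → EuclideanSpace ℝ (Fin d))
    (hH : ∀ n, IsStrategy ℱ T (H n)) (g : ℕ → ι → Ω → ℝ) (g' : ι → Ω → ℝ)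
    (hg : ∀ i, ∀ᵐ ω ∂P, Tendsto (fun n => g n i ω) atTop (𝓝 (g' i ω)))
    (hle : ∀ n i, ∀ᵐ ω ∂P, g n i ω ≤ gain (H n) (S i) T ω) :
    ∃ H', IsStrategy ℱ T H' ∧ ∀ i, ∀ᵐ ω ∂P, g' i ω ≤ gain H' (S i) T ω := by
  have hgain : ∀ (H : ℕ → Ω → EuclideanSpace ℝ (Fin d)) (h : ℕ → Ω → ℝ),
      (∀ k < T * d, ∀ ω, coord (k % d) (H (k / d + 1) ω) = h k ω) → ∀ i ω,
      gain H (S i) T ω = ∑ k ∈ Finset.range (T * d),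
        h k ω * coord (k % d) (S i (k / d + 1) ω - S i (k / d) ω) := fun H h hk i ω => by
    rw [gain_eq_sum_coord]
    exact Finset.sum_congr rfl fun k hk' => by rw [hk k (Finset.mem_range.1 hk')]
  obtain ⟨h', hh', hge⟩ := exists_sum_ge_of_tendsto P (T * d) (fun k => ℱ (k / d))
    (fun a b hab => ℱ.mono (Nat.div_le_div_right hab))
    (fun k i ω => coord (k % d) (S i (k / d + 1) ω - S i (k / d) ω))
    (fun h hh hnn => by
      obtain ⟨K, hK, hKh⟩ := exists_strategy_of_coord (T := T) h hh
      simp only [← hgain K h hKh] at hnn ⊢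
      exact hNA K hK hnn)
    -- The cutoff is needed because positions after date T carry no measurability.
    (fun n k ω => if k < T * d then coord (k % d) (H n (k / d + 1) ω) else 0)
    (fun n k => (hH n).measurable_coord k) g g' hg
    (fun n i => by
      filter_upwards [hle n i] with ω hω
      rwa [hgain (H n) _ (fun k hk ω => (if_pos hk).symm) i ω] at hω)
  obtain ⟨K, hK, hKh⟩ := exists_strategy_of_coord (T := T) h' hh'
  refine ⟨K, hK, fun i => ?_⟩
  simpa only [hgain K h' hKh] using hge i

/-! ### Weak duality -/

lemma pricing_eq_sum {Ω Θ E : Type*} {m : MeasurableSpace Ω} [NormedAddCommGroup E]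
    [NormedSpace ℝ E] (P : Measure Ω) (Z : Θ →₀ (Ω → ℝ)) (f : Θ → Ω → E) (I : Finset Θ)
    (hI : Z.support ⊆ I) : pricing P Z f = ∑ θ ∈ I, ∫ ω, Z θ ω • f θ ω ∂P :=
  Finset.sum_subset hI fun θ _ hθ => by simp [Finsupp.notMem_support_iff.1 hθ]

/-- Every superhedging capital dominates the price given by every robust pricing system. -/
theorem IsRobustPricingSystem.pricing_le {Ω Θ : Type*} {m : MeasurableSpace Ω} {d : ℕ}
    {P : Measure Ω} [IsProbabilityMeasure P] {ℱ : Filtration ℕ m} {T : ℕ}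
    {S : Θ → ℕ → Ω → EuclideanSpace ℝ (Fin d)} {Z : Θ →₀ (Ω → ℝ)}
    (hZ : IsRobustPricingSystem P ℱ T S Z) {f : Θ → Ω → ℝ} (hf : PricingIntegrable P Z f) {x : ℝ}
    {H : ℕ → Ω → EuclideanSpace ℝ (Fin d)} (hH : IsStrategy ℱ T H)
    (hx : Superhedges P T S f x H) : pricing P Z f ≤ x := by
  have hZ1 : ∀ θ, Integrable (Z θ) P := fun θ => (hZ.bounded θ).integrable (by simp)
  -- H is common to all models, so they enter only through this aggregated increment. It has zero
  -- conditional mean given ℱ t but need not be ℱ (t + 1)-measurable, as the densities are only ℱ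
  -- T-measurable.
  let D : ℕ → Ω → EuclideanSpace ℝ (Fin d) := fun t ω =>
    ∑ θ ∈ Z.support, Z θ ω • (S θ (t + 1) ω - S θ t ω)
  have hterm : ∀ t < T, ∀ θ, Integrable (fun ω => Z θ ω • (S θ (t + 1) ω - S θ t ω)) P :=
    fun t ht θ => by
      simp only [smul_sub]
      exact (hZ.integrable (t + 1) ht θ).sub (hZ.integrable t ht.le θ)
  have hD : ∀ t < T, Integrable (D t) P := fun t ht =>
    integrable_finsetSum _ fun θ _ => hterm t ht θ
  have hDA : ∀ t < T, ∀ A, MeasurableSet[ℱ t] A → ∫ ω in A, D t ω ∂P = 0 := fun t ht A hA => by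
    have hmart := hZ.martingale t ht A hA
    have hA' := ℱ.le t A hA
    rw [← sub_eq_zero] at hmart
    rw [← hmart, pricing, pricing, ← Finset.sum_sub_distrib,
      integral_finsetSum _ fun θ _ => (hterm t ht θ).integrableOn]
    refine Finset.sum_congr rfl fun θ _ => ?_
    have hind : ∀ s, (fun ω => Z θ ω • A.indicator (S θ s) ω) =
        A.indicator fun ω => Z θ ω • S θ s ω := fun s => by
      ext1 ω; by_cases hω : ω ∈ A <;> simp [hω]
    rw [hind, hind, integral_indicator hA', integral_indicator hA', ← integral_sub
      (hZ.integrable (t + 1) ht θ).integrableOn (hZ.integrable t ht.le θ).integrableOn]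
    simp only [smul_sub]
  have hgf : ∀ θ, Integrable (fun ω => Z θ ω * (x - f θ ω)) P := fun θ => by
    simp only [mul_sub]
    exact ((hZ1 θ).mul_const x).sub (hf θ)
  have hone := hZ.pricing_one
  have key := integral_nonneg_of_add_sum_nonneg P (fun k => ℱ (k / d))
    (fun a b hab => ℱ.mono (Nat.div_le_div_right hab)) (fun k => ℱ.le _)
    (fun k ω => if k < T * d then coord (k % d) (H (k / d + 1) ω) else 0)
    hH.measurable_coord (T * d) (fun k ω => coord (k % d) (D (k / d) ω))
    (fun ω => ∑ θ ∈ Z.support, Z θ ω * (x - f θ ω))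
    (fun k hk => (coord (k % d)).integrable_comp (hD _ (div_lt_of_lt_mul hk)))
    (fun k hk => by
      have hi := (coord (k % d)).integrable_comp (hD _ (div_lt_of_lt_mul hk))
      refine (ae_eq_condExp_of_forall_setIntegral_eq (ℱ.le _) hi
        (fun _ _ _ => integrableOn_zero) (fun A hA _ => ?_) aestronglyMeasurable_zero).symm
      rw [ContinuousLinearMap.integral_comp_comm _ (hD _ (div_lt_of_lt_mul hk)).integrableOn,
        hDA _ (div_lt_of_lt_mul hk) A hA]
      simp)
    (integrable_finsetSum _ fun θ _ => hgf θ)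
    (by
      have h1 : ∀ᵐ ω ∂P, ∀ θ ∈ Z.support, f θ ω ≤ x + gain H (S θ) T ω ∧ 0 ≤ Z θ ω :=
        (Finset.eventually_all _).2 fun θ _ => (hx θ).and (hZ.nonneg θ)
      filter_upwards [h1] with ω hω
      have h2 : ∑ k ∈ Finset.range (T * d), (if k < T * d then
          coord (k % d) (H (k / d + 1) ω) else 0) * coord (k % d) (D (k / d) ω) =
          ∑ θ ∈ Z.support, Z θ ω * gain H (S θ) T ω := by
        calc _ = ∑ k ∈ Finset.range (T * d), coord (k % d) (H (k / d + 1) ω) *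
              coord (k % d) (D (k / d) ω) :=
              Finset.sum_congr rfl fun k hk => by rw [if_pos (Finset.mem_range.1 hk)]
          _ = ∑ s ∈ Finset.range T, inner ℝ (H (s + 1) ω) (D s ω) :=
              (sum_inner_eq_sum_coord (fun s => H (s + 1) ω) (fun s => D s ω) T).symm
          _ = _ := by
              simp only [D, inner_sum, inner_smul_right, gain, Finset.mul_sum]
              exact Finset.sum_comm
      rw [h2, ← Finset.sum_add_distrib]
      refine Finset.sum_nonneg fun θ hθ => ?_
      rw [← mul_add]
      exact mul_nonneg (hω θ hθ).2 (by linarith [(hω θ hθ).1]))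
  rw [integral_finsetSum _ fun θ _ => hgf θ] at key
  have hsplit : ∀ θ, ∫ ω, Z θ ω * (x - f θ ω) ∂P =
      x * ∫ ω, Z θ ω • (1 : ℝ) ∂P - ∫ ω, Z θ ω • f θ ω ∂P := fun θ => by
    rw [← integral_const_mul, ← integral_sub (by simpa using (hZ1 θ).const_mul x) (hf θ)]
    exact integral_congr_ae (ae_of_all _ fun ω => by simp only [smul_eq_mul]; ring)
  simp only [hsplit, Finset.sum_sub_distrib, ← Finset.mul_sum] at key
  change 0 ≤ x * pricing P Z (fun _ _ => (1 : ℝ)) - pricing P Z f at key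
  rw [hone] at key
  linarith

/-- By Tonelli the sum of the |u n| has finite integral, so it is finite a.s. and its terms tend to
zero. -/
lemma ae_tendsto_zero_of_lintegral_le {Ω : Type*} {m : MeasurableSpace Ω} {P : Measure Ω}
    (u : ℕ → Ω → ℝ) (hu : ∀ n, AEMeasurable (u n) P)
    (hb : ∀ n, ∫⁻ ω, ‖u n ω‖ₑ ∂P ≤ 2⁻¹ ^ n) :
    ∀ᵐ ω ∂P, Tendsto (fun n => u n ω) atTop (𝓝 0) := by
  have hfin : ∫⁻ ω, ∑' n, ‖u n ω‖ₑ ∂P ≠ ∞ := by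
    rw [lintegral_tsum fun n => (hu n).enorm]
    refine ne_top_of_le_ne_top ?_ (ENNReal.tsum_le_tsum hb)
    rw [ENNReal.tsum_geometric]
    simp
  filter_upwards [ae_lt_top' (AEMeasurable.tsum fun n => (hu n).enorm) hfin] with ω hω
  exact tendsto_zero_iff_enorm_tendsto_zero.2 (ENNReal.tendsto_atTop_zero_of_tsum_ne_top hω.ne)

/-! ### Operations on strategies -/

section Strategies

variable {Ω Θ : Type*} {m : MeasurableSpace Ω} {d : ℕ}

lemma gain_add (H H' S : ℕ → Ω → EuclideanSpace ℝ (Fin d)) (T : ℕ) (ω : Ω) :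
    gain (fun t ω => H t ω + H' t ω) S T ω = gain H S T ω + gain H' S T ω := by
  simp [gain, inner_add_left, Finset.sum_add_distrib]

lemma gain_smul (r : ℝ) (H S : ℕ → Ω → EuclideanSpace ℝ (Fin d)) (T : ℕ) (ω : Ω) :
    gain (fun t ω => r • H t ω) S T ω = r * gain H S T ω := by
  simp [gain, inner_smul_left, Finset.mul_sum]

lemma gain_zero (S : ℕ → Ω → EuclideanSpace ℝ (Fin d)) (T : ℕ) (ω : Ω) :
    gain (fun _ _ => 0) S T ω = 0 := by
  simp [gain]

lemma IsStrategy.add {ℱ : Filtration ℕ m} {T : ℕ} {H H' : ℕ → Ω → EuclideanSpace ℝ (Fin d)}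
    (hH : IsStrategy ℱ T H) (hH' : IsStrategy ℱ T H') :
    IsStrategy ℱ T fun t ω => H t ω + H' t ω :=
  fun t ht => (hH t ht).add (hH' t ht)

lemma IsStrategy.smul {ℱ : Filtration ℕ m} {T : ℕ} {H : ℕ → Ω → EuclideanSpace ℝ (Fin d)}
    (hH : IsStrategy ℱ T H) (r : ℝ) : IsStrategy ℱ T fun t ω => r • H t ω :=
  fun t ht => (hH t ht).const_smul r

lemma isStrategy_zero (ℱ : Filtration ℕ m) (T : ℕ) :
    IsStrategy ℱ T (fun _ _ => (0 : EuclideanSpace ℝ (Fin d))) :=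
  fun _ _ => measurable_const

/-- Holding a fixed portfolio over one period, on an event known at the beginning of the period. -/
lemma exists_strategy_indicator {ℱ : Filtration ℕ m} {T t : ℕ} (ht : t < T) {A : Set Ω}
    (hA : MeasurableSet[ℱ t] A) (v : EuclideanSpace ℝ (Fin d)) :
    ∃ H : ℕ → Ω → EuclideanSpace ℝ (Fin d), IsStrategy ℱ T H ∧ ∀ S ω,
      gain H S T ω = inner ℝ v (A.indicator (S (t + 1)) ω - A.indicator (S t) ω) := by
  refine ⟨fun s ω => if s = t + 1 then A.indicator (fun _ => v) ω else 0, fun s _ => ?_,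
    fun S ω => ?_⟩
  · by_cases hs : s = t
    · subst hs
      simp only [if_true]
      exact measurable_const.indicator hA
    · simp only [add_left_inj, hs, if_false]
      exact measurable_const
  · rw [gain, Finset.sum_eq_single_of_mem t (Finset.mem_range.2 ht) fun s _ hs => by simp [hs]]
    by_cases hω : ω ∈ A <;> simp [hω]

/-- If the prices and claims of all models lie in the closure of those of the models `e n`, then a
strategy superhedging in the models `e n` does so in all models. -/
lemma ae_le_gain_of_mem_closure {P : Measure Ω} {T : ℕ}
    {S : Θ → ℕ → Ω → EuclideanSpace ℝ (Fin d)} {y : Θ → Ω → ℝ} {e : ℕ → Θ} {a : ℝ}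
    (he : ∀ θ, ∀ᵐ ω ∂P, ((fun t => S θ (min t T) ω : ℕ → EuclideanSpace ℝ (Fin d)), y θ ω) ∈
      closure (Set.range fun n =>
        ((fun t => S (e n) (min t T) ω : ℕ → EuclideanSpace ℝ (Fin d)), y (e n) ω)))
    {H : ℕ → Ω → EuclideanSpace ℝ (Fin d)}
    (hH : ∀ n, ∀ᵐ ω ∂P, a * y (e n) ω ≤ gain H (S (e n)) T ω) (θ : Θ) :
    ∀ᵐ ω ∂P, a * y θ ω ≤ gain H (S θ) T ω := by
  -- Freezing the path after T does not change the gain.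
  have hgain : ∀ θ ω, gain H (S θ) T ω = ∑ s ∈ Finset.range T,
      inner ℝ (H (s + 1) ω) (S θ (min (s + 1) T) ω - S θ (min s T) ω) := fun θ ω => by
    refine Finset.sum_congr rfl fun s hs => ?_
    have := Finset.mem_range.1 hs
    rw [min_eq_left (by lia : s + 1 ≤ T), min_eq_left (by lia : s ≤ T)]
  simp only [hgain] at hH ⊢
  filter_upwards [he θ, ae_all_iff.2 hH] with ω h1 h2
  have hclosed : IsClosed {q : (ℕ → EuclideanSpace ℝ (Fin d)) × ℝ |
      a * q.2 ≤ ∑ s ∈ Finset.range T, inner ℝ (H (s + 1) ω) (q.1 (s + 1) - q.1 s)} :=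
    isClosed_le (by fun_prop) (by fun_prop)
  exact closure_minimal (by rintro _ ⟨n, rfl⟩; exact h2 n) hclosed h1

end Strategies

/-! ### From separating functionals to pricing systems -/

/-- Separation of a family of claims from the claims superreplicable in finitely many models,
weighted with `φ`. -/
lemma exists_separating_densities {Ω Θ : Type*} {m : MeasurableSpace Ω} {d : ℕ} (P : Measure Ω)
    [IsProbabilityMeasure P] (ℱ : Filtration ℕ m) (T : ℕ)
    (S : Θ → ℕ → Ω → EuclideanSpace ℝ (Fin d)) (φ : Θ → Ω → ℝ)
    (hφ : ∀ θ, Measurable[ℱ T] (φ θ)) (hφ0 : ∀ θ ω, 0 < φ θ ω) (I : Finset Θ) (y : Θ → Ω → ℝ)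
    (hy : ∀ θ, Measurable[ℱ T] (y θ))
    (hyi : ∀ θ, Integrable (fun ω => φ θ ω * y θ ω) P)
    (hnot : (fun i : I => (memLp_one_iff_integrable.2 (hyi i)).toLp) ∉ closure
      {c : I → Lp ℝ 1 P | ∃ H, IsStrategy ℱ T H ∧
        ∀ i : I, ∀ᵐ ω ∂P, c i ω ≤ φ i ω * gain H (S i) T ω}) :
    ∃ W : Θ → Ω → ℝ, (∀ θ, Measurable[ℱ T] (W θ)) ∧
      (∀ θ, ∃ B : ℝ, ∀ᵐ ω ∂P, 0 ≤ W θ ω ∧ W θ ω ≤ B) ∧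
      (∀ (H : ℕ → Ω → EuclideanSpace ℝ (Fin d)) (u : Θ → Ω → ℝ), IsStrategy ℱ T H → (∀ θ, Measurable[ℱ T] (u θ)) →
        (∀ θ, Integrable (fun ω => φ θ ω * u θ ω) P) →
        (∀ θ, ∀ᵐ ω ∂P, u θ ω ≤ gain H (S θ) T ω) →
        ∑ θ ∈ I, ∫ ω, W θ ω * (φ θ ω * u θ ω) ∂P ≤ 0) ∧
      0 < ∑ θ ∈ I, ∫ ω, W θ ω * (φ θ ω * y θ ω) ∂P := by
  classical
  obtain ⟨W, B, hW, hWB, hC, hpos⟩ := exists_densities_separating P _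
    (by
      rintro c ⟨H, hH, hc⟩ c' ⟨H', hH', hc'⟩ a b ha hb -
      refine ⟨_, (hH.smul a).add (hH'.smul b), fun i => ?_⟩
      filter_upwards [hc i, hc' i, Lp.coeFn_add (a • c i) (b • c' i), Lp.coeFn_smul a (c i),
        Lp.coeFn_smul b (c' i)] with ω h1 h2 h3 h4 h5
      rw [Pi.add_apply, Pi.smul_apply, Pi.smul_apply, h3, Pi.add_apply, h4, h5, Pi.smul_apply,
        Pi.smul_apply, gain_add, gain_smul, gain_smul, smul_eq_mul, smul_eq_mul]
      nlinarith [mul_le_mul_of_nonneg_left h1 ha, mul_le_mul_of_nonneg_left h2 hb])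
    (by
      rintro c ⟨H, hH, hc⟩ r hr
      refine ⟨_, hH.smul r, fun i => ?_⟩
      filter_upwards [hc i, Lp.coeFn_smul r (c i)] with ω h1 h2
      rw [Pi.smul_apply, h2, Pi.smul_apply, gain_smul, smul_eq_mul]
      nlinarith [mul_le_mul_of_nonneg_left h1 hr.le])
    (by
      intro c hc
      refine ⟨_, isStrategy_zero ℱ T, fun i => ?_⟩
      filter_upwards [hc i] with ω h1
      simpa [gain_zero] using h1) _ hnot
  have hWi : ∀ i, Integrable (W i) P := fun i =>
    Integrable.of_bound (hW i).aestronglyMeasurable (B i) (by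
      filter_upwards [hWB i] with ω hω
      rw [Real.norm_of_nonneg hω.1]; exact hω.2)
  -- Conditioning the densities on ℱ T makes them ℱ T-measurable without changing their pairing with
  -- ℱ T-measurable claims.
  have hcond : ∀ (i : I) (c : Ω → ℝ), Measurable[ℱ T] c → Integrable c P →
      ∫ ω, (P[W i | ℱ T]) ω * c ω ∂P = ∫ ω, W i ω * c ω ∂P := fun i c hc hci => by
    have hint : Integrable (c * W i) P := by
      rw [mul_comm]
      refine hci.bdd_mul (c := B i) (hW i).aestronglyMeasurable ?_
      filter_upwards [hWB i] with ω hω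
      rw [Real.norm_of_nonneg hω.1]; exact hω.2
    have := condExp_mul_of_stronglyMeasurable_left hc.stronglyMeasurable hint (hWi i)
    calc _ = ∫ ω, (c * P[W i | ℱ T]) ω ∂P := by simp only [Pi.mul_apply, mul_comm]
      _ = ∫ ω, (P[c * W i | ℱ T]) ω ∂P := (integral_congr_ae this).symm
      _ = ∫ ω, (c * W i) ω ∂P := integral_condExp (ℱ.le T)
      _ = _ := by simp only [Pi.mul_apply, mul_comm]
  let V : Θ → Ω → ℝ := fun θ => if h : θ ∈ I then P[W ⟨θ, h⟩ | ℱ T] else 0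
  have hsum : ∀ u : Θ → Ω → ℝ, (∀ θ, Measurable[ℱ T] (u θ)) →
      (∀ θ, Integrable (fun ω => φ θ ω * u θ ω) P) →
      ∑ θ ∈ I, ∫ ω, V θ ω * (φ θ ω * u θ ω) ∂P =
        ∑ i : I, ∫ ω, W i ω * (φ i ω * u i ω) ∂P := fun u hu hui => by
    rw [← Finset.sum_coe_sort I]
    refine Finset.sum_congr rfl fun i _ => ?_
    simp only [V, i.2, dif_pos]
    exact hcond i _ ((hφ i).mul (hu i)) (hui i)
  refine ⟨V, fun θ => ?_, fun θ => ?_, fun H u hH hu hui hle => ?_, ?_⟩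
  · by_cases h : θ ∈ I
    · simp only [V, h, dif_pos]
      exact stronglyMeasurable_condExp.measurable
    · simp only [V, h, dif_neg, not_false_eq_true]
      exact measurable_const
  · by_cases h : θ ∈ I
    · refine ⟨B ⟨θ, h⟩, ?_⟩
      simp only [V, h, dif_pos]
      have h1 : 0 ≤ᵐ[P] P[W ⟨θ, h⟩ | ℱ T] := condExp_nonneg ((hWB ⟨θ, h⟩).mono fun _ hω => hω.1)
      have h2 : P[W ⟨θ, h⟩ | ℱ T] ≤ᵐ[P] P[fun _ => B ⟨θ, h⟩ | ℱ T] :=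
        condExp_mono (hWi _) (integrable_const _) ((hWB ⟨θ, h⟩).mono fun _ hω => hω.2)
      rw [condExp_const (ℱ.le T)] at h2
      filter_upwards [h1, h2] with ω a b using ⟨a, b⟩
    · exact ⟨0, ae_of_all _ fun ω => by simp [V, h]⟩
  · rw [hsum u hu hui]
    have := hC (fun i : I => (memLp_one_iff_integrable.2 (hui i)).toLp) ⟨H, hH, fun i => by
      filter_upwards [(memLp_one_iff_integrable.2 (hui i)).coeFn_toLp, hle i] with ω h1 h2
      rw [h1]
      exact mul_le_mul_of_nonneg_left h2 (hφ0 i ω).le⟩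
    refine le_trans (Finset.sum_le_sum fun i _ => le_of_eq (integral_congr_ae ?_)) this
    filter_upwards [(memLp_one_iff_integrable.2 (hui i)).coeFn_toLp] with ω h1
    rw [h1]
  · rw [hsum y hy hyi]
    refine lt_of_lt_of_le hpos (Finset.sum_le_sum fun i _ => le_of_eq (integral_congr_ae ?_))
    filter_upwards [(memLp_one_iff_integrable.2 (hyi i)).coeFn_toLp] with ω h1
    rw [h1]

lemma map_pricing {Ω Θ E F : Type*} {m : MeasurableSpace Ω} [NormedAddCommGroup E]
    [NormedSpace ℝ E] [CompleteSpace E] [NormedAddCommGroup F] [NormedSpace ℝ F] [CompleteSpace F]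
    {P : Measure Ω} {Z : Θ →₀ (Ω → ℝ)} {f : Θ → Ω → E} (hf : PricingIntegrable P Z f)
    (L : E →L[ℝ] F) : L (pricing P Z f) = pricing P Z fun θ ω => L (f θ ω) := by
  rw [pricing, pricing, map_sum]
  refine Finset.sum_congr rfl fun θ _ => ?_
  rw [← L.integral_comp_comm (hf θ)]
  simp only [map_smul]

lemma pricing_sub {Ω Θ E : Type*} {m : MeasurableSpace Ω} [NormedAddCommGroup E]
    [NormedSpace ℝ E] {P : Measure Ω} {Z : Θ →₀ (Ω → ℝ)} {f g : Θ → Ω → E}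
    (hf : PricingIntegrable P Z f) (hg : PricingIntegrable P Z g) :
    pricing P Z (fun θ ω => f θ ω - g θ ω) = pricing P Z f - pricing P Z g := by
  simp only [pricing, smul_sub]
  rw [← Finset.sum_sub_distrib]
  exact Finset.sum_congr rfl fun θ _ => integral_sub (hf θ) (hg θ)

lemma PricingIntegrable.indicator {Ω Θ E : Type*} {m : MeasurableSpace Ω} [NormedAddCommGroup E]
    [NormedSpace ℝ E] {P : Measure Ω} {Z : Θ →₀ (Ω → ℝ)} {f : Θ → Ω → E}
    (hf : PricingIntegrable P Z f) {A : Set Ω} (hA : MeasurableSet A) :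
    PricingIntegrable P Z fun θ => A.indicator (f θ) := fun θ => by
  refine ((hf θ).indicator hA).congr (ae_of_all _ fun ω => ?_)
  by_cases hω : ω ∈ A <;> simp [hω]

/-- A finitely supported nonnegative density family that prices all superreplicable claims
nonpositively, normalised, is a robust pricing system. -/
lemma isRobustPricingSystem_smul {Ω Θ : Type*} {m : MeasurableSpace Ω} {d : ℕ} {P : Measure Ω}
    [IsProbabilityMeasure P] {ℱ : Filtration ℕ m} {T : ℕ}
    {S : Θ → ℕ → Ω → EuclideanSpace ℝ (Fin d)} {Z : Θ →₀ (Ω → ℝ)}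
    (hZm : ∀ θ, Measurable[ℱ T] (Z θ)) (hZb : ∀ θ, MemLp (Z θ) ∞ P)
    (hZ0 : ∀ θ, ∀ᵐ ω ∂P, 0 ≤ Z θ ω) (hZS : ∀ t ≤ T, PricingIntegrable P Z fun θ => S θ t)
    (hgain : ∀ t < T, ∀ A, MeasurableSet[ℱ t] A → ∀ v : EuclideanSpace ℝ (Fin d),
      pricing P Z (fun θ ω => inner ℝ v (A.indicator (S θ (t + 1)) ω - A.indicator (S θ t) ω)) ≤ 0)
    (hone : 0 < pricing P Z fun _ _ => (1 : ℝ)) :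
    IsRobustPricingSystem P ℱ T S ((pricing P Z fun _ _ => (1 : ℝ))⁻¹ • Z) := by
  set q := pricing P Z fun _ _ => (1 : ℝ) with hq
  have hq0 : q⁻¹ ≠ 0 := inv_ne_zero hone.ne'
  have hscale : ∀ {E : Type} [NormedAddCommGroup E] [NormedSpace ℝ E] (u : Θ → Ω → E),
      pricing P (q⁻¹ • Z) u = q⁻¹ • pricing P Z u := fun u => by
    rw [pricing, Finsupp.support_smul_eq hq0, pricing, Finset.smul_sum]
    refine Finset.sum_congr rfl fun θ _ => ?_
    rw [← integral_smul]
    simp [mul_smul]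
  have hmart : ∀ t < T, ∀ A : Set Ω, MeasurableSet[ℱ t] A →
      pricing P Z (fun θ => A.indicator (S θ (t + 1))) =
        pricing P Z (fun θ => A.indicator (S θ t)) := fun t ht A hA => by
    have h1 := (hZS (t + 1) ht).indicator (ℱ.le t A hA)
    have h2 := (hZS t ht.le).indicator (ℱ.le t A hA)
    have hi : PricingIntegrable P Z
        fun θ ω => A.indicator (S θ (t + 1)) ω - A.indicator (S θ t) ω := fun θ => by
      simp only [smul_sub]; exact (h1 θ).sub (h2 θ)
    -- The priced increment is a vector with nonpositive inner product with every v; taking v to be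
    -- plus or minus this vector forces it to vanish.
    rw [← sub_eq_zero, ← pricing_sub h1 h2, ← inner_self_eq_zero (𝕜 := ℝ)]
    have hle : ∀ v, inner ℝ v (pricing P Z
        fun θ ω => A.indicator (S θ (t + 1)) ω - A.indicator (S θ t) ω) ≤ 0 := fun v => by
      have := map_pricing hi (innerSL ℝ v)
      simp only [innerSL_apply_apply] at this
      rw [this]
      exact hgain t ht A hA v
    refine le_antisymm (hle _) ?_
    have := hle (-(pricing P Z
        fun θ ω => A.indicator (S θ (t + 1)) ω - A.indicator (S θ t) ω))
    rw [inner_neg_left] at this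
    linarith
  constructor
  · exact fun θ => (hZm θ).const_smul q⁻¹
  · exact fun θ => (hZb θ).const_smul q⁻¹
  · intro θ
    filter_upwards [hZ0 θ] with ω hω using mul_nonneg (inv_nonneg.2 hone.le) hω
  · by_contra! hno
    have hzero : q ≤ 0 := by
      rw [hq]
      refine Finset.sum_nonpos fun θ _ => ?_
      have := hno θ Set.univ MeasurableSet.univ
      rw [setIntegral_univ] at this
      have e : ∫ ω, (q⁻¹ • Z) θ ω ∂P = q⁻¹ * ∫ ω, Z θ ω ∂P := by
        rw [← integral_const_mul]; rfl
      rw [e] at this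
      simpa using nonpos_of_mul_nonpos_right this (inv_pos.2 hone)
    exact absurd hone hzero.not_gt
  · rw [hscale, ← hq, smul_eq_mul, inv_mul_cancel₀ hone.ne']
  · intro t ht θ
    refine ((hZS t ht θ).smul q⁻¹).congr (ae_of_all _ fun ω => ?_)
    simp [mul_smul]
  · intro t ht A hA
    rw [hscale, hscale, hmart t ht A hA]

/-! ### The alternative -/

/-- Either the claims `y` can be superreplicated in all models at zero cost, or some robust pricing
system assigns a positive price to them. -/
theorem exists_strategy_or_pricing_pos {Ω Θ : Type*} {m : MeasurableSpace Ω} {d : ℕ}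
    [Nonempty Θ] (P : Measure Ω) [IsProbabilityMeasure P] (ℱ : Filtration ℕ m) (T : ℕ)
    (S : Θ → ℕ → Ω → EuclideanSpace ℝ (Fin d)) (hS : ∀ θ, ∀ t ≤ T, Measurable[ℱ t] (S θ t))
    (hNRA : NoRobustArbitrage P ℱ T S) (f y : Θ → Ω → ℝ) (hf : ∀ θ, Measurable[ℱ T] (f θ))
    (hy : ∀ θ, Measurable[ℱ T] (y θ)) :
    (∃ H, IsStrategy ℱ T H ∧ ∀ θ, ∀ᵐ ω ∂P, y θ ω ≤ gain H (S θ) T ω) ∨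
    ∃ Z, IsRobustPricingSystem P ℱ T S Z ∧ PricingIntegrable P Z f ∧ PricingIntegrable P Z y ∧
      0 < pricing P Z y := by
  classical
  have hST : ∀ θ, ∀ t ≤ T, Measurable[ℱ T] (S θ t) := fun θ t ht =>
    (hS θ t ht).mono (ℱ.mono ht) le_rfl
  -- Weighting by 1/N bounds prices and claims by 1. Including f ensures that the system found
  -- prices f, whatever y is.
  let N : Θ → Ω → ℝ := fun θ ω => 1 + |f θ ω| + |y θ ω| + ∑ t ∈ Finset.range (T + 1), ‖S θ t ω‖
  have hsum0 : ∀ θ ω, 0 ≤ ∑ t ∈ Finset.range (T + 1), ‖S θ t ω‖ := fun θ ω =>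
    Finset.sum_nonneg fun _ _ => norm_nonneg _
  have hN1 : ∀ θ ω, 1 ≤ N θ ω := fun θ ω => by
    have := hsum0 θ ω; have := abs_nonneg (f θ ω); have := abs_nonneg (y θ ω)
    simp only [N]; linarith
  have hNf : ∀ θ ω, ‖f θ ω‖ ≤ N θ ω := fun θ ω => by
    have := hsum0 θ ω; have := abs_nonneg (y θ ω)
    rw [Real.norm_eq_abs]; simp only [N]; linarith
  have hNy : ∀ θ ω, ‖y θ ω‖ ≤ N θ ω := fun θ ω => by
    have := hsum0 θ ω; have := abs_nonneg (f θ ω)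
    rw [Real.norm_eq_abs]; simp only [N]; linarith
  have hNS : ∀ t ≤ T, ∀ θ ω, ‖S θ t ω‖ ≤ N θ ω := fun t ht θ ω => by
    have := Finset.single_le_sum (f := fun t => ‖S θ t ω‖) (fun _ _ => norm_nonneg _)
      (Finset.mem_range.2 (Nat.lt_succ_of_le ht))
    have := abs_nonneg (f θ ω); have := abs_nonneg (y θ ω)
    simp only [N]; linarith
  have hNm : ∀ θ, Measurable[ℱ T] (N θ) := fun θ => by
    let := ℱ T
    exact ((measurable_const.add (measurable_norm.comp (hf θ))).add
      (measurable_norm.comp (hy θ))).add (Finset.measurable_sum _ fun t ht =>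
        measurable_norm.comp (hST θ t (Nat.le_of_lt_succ (Finset.mem_range.1 ht))))
  let φ : Θ → Ω → ℝ := fun θ ω => (N θ ω)⁻¹
  have hφm : ∀ θ, Measurable[ℱ T] (φ θ) := fun θ => (hNm θ).inv
  have hφ0 : ∀ θ ω, 0 < φ θ ω := fun θ ω => inv_pos.2 (one_pos.trans_le (hN1 θ ω))
  have hφb : ∀ {E : Type} [NormedAddCommGroup E] [NormedSpace ℝ E] (θ : Θ) (u : Ω → E) (b : ℝ)
      (ω : Ω), ‖u ω‖ ≤ b * N θ ω → ‖φ θ ω • u ω‖ ≤ b := fun θ u b ω hu => by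
    have := one_pos.trans_le (hN1 θ ω)
    rw [norm_smul, norm_inv, Real.norm_of_nonneg this.le, inv_mul_le_iff₀ this, mul_comm]
    exact hu
  have hφint : ∀ (u : Θ → Ω → ℝ) (b : ℝ), (∀ θ, Measurable[ℱ T] (u θ)) →
      (∀ θ ω, ‖u θ ω‖ ≤ b * N θ ω) → ∀ θ, Integrable (fun ω => φ θ ω * u θ ω) P :=
    fun u b hu hub θ => by
      refine Integrable.of_bound (((hφm θ).mul (hu θ)).mono (ℱ.le T) le_rfl).aestronglyMeasurable
        b (ae_of_all _ fun ω => hφb θ (u θ) b ω (hub θ ω))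
  have hyi := hφint y 1 hy fun θ ω => by rw [one_mul]; exact hNy θ ω
  -- a sequence of models representing all of them
  obtain ⟨e, he⟩ : ∃ e : ℕ → Θ, ∀ θ, ∀ᵐ ω ∂P,
      ((fun t => S θ (min t T) ω : ℕ → EuclideanSpace ℝ (Fin d)), y θ ω) ∈
      closure (Set.range fun n =>
        ((fun t => S (e n) (min t T) ω : ℕ → EuclideanSpace ℝ (Fin d)), y (e n) ω)) := by
    obtain ⟨s, hs, hsV⟩ := exists_countable_ae_mem_closure P
      (fun θ ω => ((fun t => S θ (min t T) ω : ℕ → EuclideanSpace ℝ (Fin d)), y θ ω)) fun θ =>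
        (measurable_pi_lambda _ fun t => (hST θ _ (min_le_right t T)).mono (ℱ.le T) le_rfl).prodMk
          ((hy θ).mono (ℱ.le T) le_rfl)
    obtain ⟨e, hes⟩ := Set.countable_iff_exists_subset_range.1 hs
    refine ⟨e, fun θ => (hsV θ).mono fun ω hω => closure_mono ?_ hω⟩
    rintro _ ⟨θ', hθ', rfl⟩
    obtain ⟨n, rfl⟩ := hes hθ'
    exact ⟨n, rfl⟩
  have hNA : NoRobustArbitrage P ℱ T fun n => S (e n) := fun H hH h0 n => by
    refine hNRA H hH (fun θ => ?_) (e n)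
    have := ae_le_gain_of_mem_closure (a := 0) he (H := H) (fun n => by simpa using h0 n) θ
    simpa using this
  let I : ℕ → Finset Θ := fun n => (Finset.range n).image e
  -- Closure in the product topology is tested on finite subfamilies; failure at one n gives a
  -- functional of finite support.
  by_cases hcl : ∀ n, (fun i : I n => (memLp_one_iff_integrable.2 (hyi i)).toLp) ∈ closure
      {c : I n → Lp ℝ 1 P | ∃ H, IsStrategy ℱ T H ∧
        ∀ i : I n, ∀ᵐ ω ∂P, c i ω ≤ φ i ω * gain H (S i) T ω}
  · left
    have hpos : ∀ n : ℕ, (0 : ℝ≥0∞) < 2⁻¹ ^ n := fun n => ENNReal.pow_pos (by simp) n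
    choose c hc hdist using fun n => EMetric.mem_closure_iff.1 (hcl n) _ (hpos n)
    choose H hH hcH using hc
    let D : ℕ → Θ → Ω → ℝ := fun n θ => if h : θ ∈ I n then
      (((memLp_one_iff_integrable.2 (hyi θ)).toLp - c n ⟨θ, h⟩ : Lp ℝ 1 P) : Ω → ℝ) else 0
    have hD : ∀ θ, ∀ᵐ ω ∂P, Tendsto (fun n => D n θ ω) atTop (𝓝 0) := fun θ => by
      refine ae_tendsto_zero_of_lintegral_le _ (fun n => ?_) fun n => ?_
      · by_cases h : θ ∈ I n
        · simp only [D, h, dif_pos]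
          exact (Lp.aestronglyMeasurable _).aemeasurable
        · simp only [D, h, dif_neg, not_false_eq_true]
          exact aemeasurable_const
      · by_cases h : θ ∈ I n
        · simp only [D, h, dif_pos]
          rw [← eLpNorm_one_eq_lintegral_enorm, ← Lp.enorm_def, ← edist_eq_enorm_sub]
          exact (edist_le_pi_edist (fun i : I n => (memLp_one_iff_integrable.2 (hyi i)).toLp)
            (c n) ⟨θ, h⟩).trans (hdist n).le
        · simp [D, h]
    -- For a model outside `I n` the claim is replaced by the gain itself, which is trivially
    -- dominated; every `e j` lies in `I n` once n > j.
    obtain ⟨K, hK, hyK⟩ := exists_strategy_of_tendsto P ℱ T (fun n => S (e n)) hNA H hH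
      (fun n j ω => if e j ∈ I n then y (e j) ω - D n (e j) ω * N (e j) ω
        else gain (H n) (S (e j)) T ω) (fun j => y (e j))
      (fun j => by
        filter_upwards [hD (e j)] with ω hω
        have h1 : Tendsto (fun n => y (e j) ω - D n (e j) ω * N (e j) ω) atTop
            (𝓝 (y (e j) ω - 0 * N (e j) ω)) := tendsto_const_nhds.sub (hω.mul_const _)
        rw [zero_mul, sub_zero] at h1
        refine h1.congr' ?_
        filter_upwards [eventually_gt_atTop j] with n hn
        rw [if_pos (Finset.mem_image_of_mem e (Finset.mem_range.2 hn))])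
      (fun n j => by
        by_cases h : e j ∈ I n
        · simp only [h, if_true, D, dif_pos]
          filter_upwards [hcH n ⟨e j, h⟩, (memLp_one_iff_integrable.2 (hyi (e j))).coeFn_toLp,
            Lp.coeFn_sub (memLp_one_iff_integrable.2 (hyi (e j))).toLp (c n ⟨e j, h⟩)]
            with ω h1 h2 h3
          have hNpos := one_pos.trans_le (hN1 (e j) ω)
          rw [h3, Pi.sub_apply, h2]
          have h4 := mul_le_mul_of_nonneg_right h1 hNpos.le
          have h5 : φ (e j) ω * N (e j) ω = 1 := inv_mul_cancel₀ hNpos.ne'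
          calc _ = c n ⟨e j, h⟩ ω * N (e j) ω := by linear_combination (- y (e j) ω) * h5
            _ ≤ _ := h4
            _ = _ := by linear_combination gain (H n) (S (e j)) T ω * h5
        · simp [h])
    refine ⟨K, hK, fun θ => ?_⟩
    have := ae_le_gain_of_mem_closure (a := 1) he (H := K) (fun n => by simpa using hyK n) θ
    simpa using this
  · right
    push Not at hcl
    obtain ⟨n, hn⟩ := hcl
    obtain ⟨W, hWm, hWb, hWH, hWy⟩ := exists_separating_densities P ℱ T S φ hφm hφ0 (I n) y hy hyi hn
    let Z : Θ →₀ (Ω → ℝ) := Finsupp.onFinset (I n)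
      (fun θ => if θ ∈ I n then fun ω => W θ ω * φ θ ω else 0) fun θ h => by
        by_contra hθ; simp [hθ] at h
    have hZW : ∀ θ ∈ I n, Z θ = fun ω => W θ ω * φ θ ω := fun θ h => by simp [Z, h]
    have hZ0 : ∀ θ ∉ I n, Z θ = 0 := fun θ h => by simp [Z, h]
    have hprice : ∀ u : Θ → Ω → ℝ, pricing P Z u =
        ∑ θ ∈ I n, ∫ ω, W θ ω * (φ θ ω * u θ ω) ∂P := fun u => by
      rw [pricing_eq_sum P Z u (I n) Finsupp.support_onFinset_subset]
      refine Finset.sum_congr rfl fun θ h => ?_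
      simp [hZW θ h, mul_assoc]
    have hPI : ∀ {E : Type} [NormedAddCommGroup E] [NormedSpace ℝ E] [SecondCountableTopology E]
        [MeasurableSpace E] [BorelSpace E] (u : Θ → Ω → E) (b : ℝ),
        (∀ θ, Measurable[ℱ T] (u θ)) → (∀ θ ω, ‖u θ ω‖ ≤ b * N θ ω) →
        PricingIntegrable P Z u := fun {E} _ _ _ _ _ u b hu hub θ => by
      by_cases h : θ ∈ I n
      · obtain ⟨B, hB⟩ := hWb θ
        have hi : Integrable (fun ω => φ θ ω • u θ ω) P :=
          Integrable.of_bound ((((hφm θ).mono (ℱ.le T) le_rfl).aestronglyMeasurable).smul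
            (((hu θ).mono (ℱ.le T) le_rfl).aestronglyMeasurable)) b
            (ae_of_all _ fun ω => hφb θ (u θ) b ω (hub θ ω))
        have := hi.bdd_smul B ((hWm θ).mono (ℱ.le T) le_rfl).aestronglyMeasurable (by
          filter_upwards [hB] with ω hω
          rw [Real.norm_of_nonneg hω.1]; exact hω.2)
        refine this.congr (ae_of_all _ fun ω => ?_)
        simp [hZW θ h, mul_smul]
      · simp [hZ0 θ h]
    have hZnn : ∀ θ, ∀ᵐ ω ∂P, 0 ≤ Z θ ω := fun θ => by
      by_cases h : θ ∈ I n
      · obtain ⟨B, hB⟩ := hWb θ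
        filter_upwards [hB] with ω hω
        rw [hZW θ h]
        exact mul_nonneg hω.1 (hφ0 θ ω).le
      · simp [hZ0 θ h]
    have hZm : ∀ θ, Measurable[ℱ T] (Z θ) := fun θ => by
      by_cases h : θ ∈ I n
      · rw [hZW θ h]; exact (hWm θ).mul (hφm θ)
      · rw [hZ0 θ h]; exact measurable_const
    have hZb : ∀ θ, MemLp (Z θ) ∞ P := fun θ => by
      by_cases h : θ ∈ I n
      · obtain ⟨B, hB⟩ := hWb θ
        refine memLp_top_of_bound ((hZm θ).mono (ℱ.le T) le_rfl).aestronglyMeasurable B ?_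
        filter_upwards [hB] with ω hω
        rw [hZW θ h, norm_mul, Real.norm_of_nonneg hω.1, Real.norm_of_nonneg (hφ0 θ ω).le]
        exact (mul_le_of_le_one_right hω.1 (inv_le_one_of_one_le₀ (hN1 θ ω))).trans hω.2
      · rw [hZ0 θ h]; exact MemLp.zero
    have hPIy : PricingIntegrable P Z y := hPI y 1 hy fun θ ω => by rw [one_mul]; exact hNy θ ω
    have hPIf : PricingIntegrable P Z f := hPI f 1 hf fun θ ω => by rw [one_mul]; exact hNf θ ω
    have hPIS : ∀ t ≤ T, PricingIntegrable P Z fun θ => S θ t := fun t ht =>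
      hPI _ 1 (fun θ => hST θ t ht) fun θ ω => by rw [one_mul]; exact hNS t ht θ ω
    have hypos : 0 < pricing P Z y := by rw [hprice]; exact hWy
    -- If Q(1) were zero, the nonnegative densities would all vanish a.s., against Q(y) > 0.
    have hone : 0 < pricing P Z fun _ _ => (1 : ℝ) := by
      by_contra! hle
      have hnn : ∀ θ, 0 ≤ ∫ ω, Z θ ω • (1 : ℝ) ∂P := fun θ =>
        integral_nonneg_of_ae ((hZnn θ).mono fun ω hω => by simpa using hω)
      have hall := (Finset.sum_eq_zero_iff_of_nonneg fun θ _ => hnn θ).1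
        (le_antisymm hle (Finset.sum_nonneg fun θ _ => hnn θ))
      refine hypos.ne' (Finset.sum_eq_zero fun θ hθ => ?_)
      have h1 := hall θ hθ
      simp only [smul_eq_mul, mul_one] at h1
      rw [integral_eq_zero_iff_of_nonneg_ae (hZnn θ) ((hZb θ).integrable (by simp))] at h1
      refine integral_eq_zero_of_ae ?_
      filter_upwards [h1] with ω hω
      simp [hω]
    have hsys := isRobustPricingSystem_smul (ℱ := ℱ) hZm hZb hZnn hPIS (fun t ht A hA v => by
      obtain ⟨H, hH, hgain⟩ := exists_strategy_indicator ht hA v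
      rw [hprice]
      have hum : ∀ θ, Measurable[ℱ T] fun ω =>
          (inner ℝ v (A.indicator (S θ (t + 1)) ω - A.indicator (S θ t) ω) : ℝ) := fun θ => by
        let := ℱ T
        have hA' := ℱ.mono ht.le A hA
        exact measurable_const.inner
          (((hST θ _ ht).indicator hA').sub ((hST θ _ ht.le).indicator hA'))
      refine hWH H _ hH hum (hφint _ (‖v‖ * 2) hum fun θ ω => ?_)
        fun θ => ae_of_all _ fun ω => (hgain (S θ) ω).ge
      refine (norm_inner_le_norm _ _).trans ?_
      rw [mul_assoc, two_mul]
      gcongr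
      refine (norm_sub_le _ _).trans (add_le_add ?_ ?_)
      · exact (norm_indicator_le_norm_self _ _).trans (hNS _ ht θ ω)
      · exact (norm_indicator_le_norm_self _ _).trans (hNS _ ht.le θ ω)) hone
    have hq := inv_pos.2 hone
    have hPIq : ∀ u : Θ → Ω → ℝ, PricingIntegrable P Z u →
        PricingIntegrable P ((pricing P Z fun _ _ => (1 : ℝ))⁻¹ • Z) u := fun u hu θ => by
      refine ((hu θ).smul (pricing P Z fun _ _ => (1 : ℝ))⁻¹).congr (ae_of_all _ fun ω => ?_)
      simp [mul_assoc]
    refine ⟨_, hsys, hPIq f hPIf, hPIq y hPIy, ?_⟩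
    rw [pricing, Finsupp.support_smul_eq hq.ne']
    have := mul_pos hq hypos
    rw [pricing.eq_1 P Z y, Finset.mul_sum] at this
    refine this.trans_eq (Finset.sum_congr rfl fun θ _ => ?_)
    rw [← integral_const_mul]
    simp [mul_assoc]

end RobustFinance

/-! ### The duality theorem -/

theorem mainTheorem2 {Ω E : Type*} {m : MeasurableSpace Ω} (P : Measure Ω) [IsProbabilityMeasure P]
    (T d : ℕ) (ℱ : Filtration ℕ m)
    [MetricSpace E] [TopologicalSpace.SeparableSpace E]
    (Θ : Set E) (hΘ : IsClosed Θ) (hΘne : Θ.Nonempty)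
    (S : Θ → ℕ → Ω → EuclideanSpace ℝ (Fin d))
    (hS : ∀ θ, ∀ t ≤ T, Measurable[ℱ t] (S θ t))
    (hcont : RobustFinance.ContinuousInParameter P T S)
    (hNRA : RobustFinance.NoRobustArbitrage P ℱ T S)
    (f : Θ → Ω → ℝ) (hf : ∀ θ, Measurable[ℱ T] (f θ))
    (hsup : RobustFinance.supPrice P ℱ T S f < ⊤) :
    RobustFinance.superhedgingPrice P ℱ T S f = RobustFinance.supPrice P ℱ T S f ∧
    ∃ p : ℝ, RobustFinance.superhedgingPrice P ℱ T S f = (p : EReal) ∧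
      ∃ H : ℕ → Ω → EuclideanSpace ℝ (Fin d),
        RobustFinance.IsStrategy ℱ T H ∧ RobustFinance.Superhedges P T S f p H := by
  open RobustFinance in
  have : Nonempty Θ := hΘne.to_subtype
  -- A positive integral over some A makes Z^θ nonzero, so every system belongs to some 𝒬^θ.
  have hle : ∀ Z, IsRobustPricingSystem P ℱ T S Z → PricingIntegrable P Z f →
      ((pricing P Z f : ℝ) : EReal) ≤ supPrice P ℱ T S f := fun Z hZ hZf => by
    obtain ⟨θ, A, -, hA⟩ := hZ.pos
    refine le_iSup_of_le θ (le_iSup₂_of_le Z ⟨hZ, fun h0 => hA.ne' ?_⟩ (le_iSup_of_le hZf le_rfl))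
    exact integral_eq_zero_of_ae (ae_restrict_of_ae h0)
  have hweak : supPrice P ℱ T S f ≤ superhedgingPrice P ℱ T S f :=
    iSup_le fun θ => iSup₂_le fun Z hZ => iSup_le fun hZf => le_iInf₂ fun x ⟨H, hH, hx⟩ =>
      EReal.coe_le_coe_iff.2 (hZ.1.pricing_le hZf hH hx)
  have hbot : supPrice P ℱ T S f ≠ ⊥ := by
    rcases exists_strategy_or_pricing_pos P ℱ T S hS hNRA f (fun _ _ => 1) hf
      (fun _ => measurable_const) with ⟨H, hH, h1⟩ | ⟨Z, hZ, hZf, -, -⟩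
    · exfalso
      obtain ⟨θ⟩ := this
      have h0 := hNRA H hH (fun θ => (h1 θ).mono fun ω hω => zero_le_one.trans hω) θ
      obtain ⟨ω, hω, hω'⟩ := ((h1 θ).and h0).exists
      linarith
    · exact ne_bot_of_le_ne_bot (EReal.coe_ne_bot _) (hle Z hZ hZf)
  obtain ⟨p, hp⟩ : ∃ p : ℝ, supPrice P ℱ T S f = p :=
    ⟨_, (EReal.coe_toReal hsup.ne hbot).symm⟩
  have hH : ∃ H, IsStrategy ℱ T H ∧ Superhedges P T S f p H := by
    rcases exists_strategy_or_pricing_pos P ℱ T S hS hNRA f (fun θ ω => f θ ω - p) hf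
      (fun θ => (hf θ).sub_const p) with ⟨H, hH, h1⟩ | ⟨Z, hZ, hZf, -, hpos⟩
    · exact ⟨H, hH, fun θ => (h1 θ).mono fun ω hω => by linarith⟩
    · exfalso
      have hone : PricingIntegrable P Z fun _ _ => p := fun θ =>
        ((hZ.bounded θ).integrable (by simp)).mul_const p
      have hprice : pricing P Z (fun _ _ => p) = p := by
        have := congrArg (p * ·) hZ.pricing_one
        simp only [pricing, Finset.mul_sum, mul_one, smul_eq_mul] at this ⊢
        refine Eq.trans ?_ this
        exact Finset.sum_congr rfl fun θ _ => by rw [integral_mul_const, mul_comm]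
      rw [pricing_sub hZf hone, hprice] at hpos
      have := hle Z hZ hZf
      rw [hp, EReal.coe_le_coe_iff] at this
      linarith
  have heq : superhedgingPrice P ℱ T S f = supPrice P ℱ T S f :=
    le_antisymm (hp ▸ iInf₂_le p hH) hweak
  exact ⟨heq, p, heq.trans hp, hH⟩
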